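/- **Setting.** Let $\mathcal A$ be a central and essential hyperplane arrangement in a real vector space $V$ of dimension $n$, and let $\mathcal L$ be its lattice of flats, i.e. the set of all intersections of hyperplanes of $\mathcal A$ ordered by reverse inclusion; its bottom element is $V$ and its top element is $\{0\}$. For flats $X\le Y$ let $$\operatorname{Poin}([X,Y];y)=\sum_{Z\in[X,Y]}\mu(X,Z)\,(-y)^{\dim X-\dim Z},$$ where $\mu$ is the Möbius function of $\mathcal L$. For a chain $\mathcal C=\{C_1<\dots<C_k\}$ in $\mathcal L$ put $$\operatorname{Poin}_{\mathcal C}(y)=\prod_{i=0}^{k}\operatorname{Poin}([C_i,C_{i+1}];y),\qquad C_0=V,\ C_{k+1}=\{0\}.$$ The coarse flag Hilbert–Poincaré series of $\mathcal A$ (Maglione–Voll) and its numerator polynomial $\mathcal N_{\mathcal A}(y,t)$ are given by $$\operatorname{cfHP}_{\mathcal A}(y,t)=\sum_{\mathcal C}\operatorname{Poin}_{\mathcal C}(y)\left(\frac{t}{1-t}\right)^{\#\mathcal C}=\frac{\mathcal N_{\mathcal A}(y,t)}{(1-t)^n},$$ where the sum ranges over all chains $\mathcal C$ in $\mathcal L$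 (including the empty one) that do not contain $V$. For $n\ge 0$, let $\mathcal B_n$ be the braid arrangement, consisting of the hyperplanes $x_i=x_j$, $1\le i<j\le n+1$, in the $n$-dimensional space $\{x\in\mathbb R^{n+1}: x_1+\dots+x_{n+1}=0\}$. **Statistics.** Let $w\in\mathfrak S_{n+1}$ and $\sigma\in\operatorname{Sym}(n)$. Write $w=w_1|w_2|\cdots|w_{n+1}$ in one-line notation, with bars numbered $1,\dots,n$ from left to right, regarded as an ordered set partition of $\{1,\dots,n+1\}$ into singletons. Delete the bars numbered $\sigma(1),\sigma(2),\dots,\sigma(n)$ in this order; deleting bar $\sigma(i)$ in step $i$ merges the two blocks $B|B'$ adjacent to it at that moment into $B\cup B'$. Let $\operatorname{ino}(w,\sigma)$ be the number of $i\in\{1,\dots,n\}$ such that the blocks $B|B'$ merged in step $i$ satisfy $\min(B)<\min(B')$. Let $\operatorname{des}(\sigma)$ be the number of $i\in\{1,\dots,n-1\}$ with $\sigma(i)>\sigma(i+1)$. **Theorem.** For every $n\ge 0$, the numerator polynomial of the coarse flag Hilbert–Poincaré series of the braid arrangement $\mathcal B_n$ is $$\mathcal N_{\mathcal B_n}(y,t)=\sum_{\substack{w\in\mathfrak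 S_{n+1}\\ \sigma\in\operatorname{Sym}(n)}}y^{\operatorname{ino}(w,\sigma)}\,t^{\operatorname{des}(\sigma)}.$$ -/

import Mathlib

open Polynomial

noncomputable section

/-! ### Hyperplane arrangements, flats and the coarse flag Hilbert-Poincaré series -/

/-- A central and essential hyperplane arrangement in a real vector space `V`: a finite set of
linear hyperplanes whose common intersection is `0`. -/
structure HyperplaneArrangement (V : Type*) [AddCommGroup V] [Module ℝ V] where
  hyperplanes : Set (Submodule ℝ V)
  finite : hyperplanes.Finite
  isCoatom : ∀ H ∈ hyperplanes, IsCoatom H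
  essential : sInf hyperplanes = ⊥

namespace HyperplaneArrangement

variable {V : Type*} [AddCommGroup V] [Module ℝ V] (A : HyperplaneArrangement V)

/-- The flats of `A`: all intersections of hyperplanes of `A` (the empty one being `V`). -/
@[ext] structure Flat where
  space : Submodule ℝ V
  isFlat : ∃ S ⊆ A.hyperplanes, space = sInf S

/-- Flats are ordered by reverse inclusion. -/
instance : PartialOrder A.Flat :=
  PartialOrder.lift (fun X => OrderDual.toDual X.space) fun _ _ h => Flat.ext h

theorem Flat.le_iff {X Y : A.Flat} : X ≤ Y ↔ Y.space ≤ X.space := Iff.rfl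

/-- The bottom flat is `V` and the top flat is `0`. -/
instance : BoundedOrder A.Flat where
  bot := ⟨⊤, ∅, Set.empty_subset _, sInf_empty.symm⟩
  bot_le X := (le_top : X.space ≤ ⊤)
  top := ⟨⊥, A.hyperplanes, subset_rfl, A.essential.symm⟩
  le_top X := (bot_le : ⊥ ≤ X.space)

instance : Finite A.Flat := by
  have h : Finite (Set.powerset A.hyperplanes) := A.finite.powerset.to_subtype
  refine Finite.of_surjective
    (fun S : Set.powerset A.hyperplanes => (⟨sInf S.1, S.1, S.2, rfl⟩ : A.Flat)) ?_
  rintro ⟨X, S, hS, rfl⟩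
  exact ⟨⟨S, hS⟩, rfl⟩

instance : Fintype A.Flat := Fintype.ofFinite _

open Classical in
instance : LocallyFiniteOrder A.Flat := Fintype.toLocallyFiniteOrder

open Classical in
/-- The Poincaré polynomial `∑ μ(X, Z) (-y) ^ rk(X, Z)`, over `Z` in the interval `[X, Y]` of the
lattice of flats, where `rk(X, Z)` is the codimension of `Z` in `X`. -/
def poin (X Y : A.Flat) : ℤ[X] :=
  ∑ Z ∈ Finset.Icc X Y, C (IncidenceAlgebra.mu ℤ X Z) *
    (-Polynomial.X) ^ (Module.finrank ℝ X.space - Module.finrank ℝ Z.space)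

/-- The chains `C₁ < C₂ < ⋯ < C_k` (`k ≥ 0`) of flats which do not contain the bottom `V`. -/
def Chain : Type _ := {c : List A.Flat // (⊥ :: c).IsChain (· < ·)}

instance : Finite A.Chain := by
  classical
  have : Finite {l : List A.Flat // l.Nodup} := Fintype.finite fintypeNodupList
  refine Finite.of_injective
    (fun c : A.Chain => (⟨c.1, ?_⟩ : {l : List A.Flat // l.Nodup})) ?_
  · have h := (List.isChain_iff_pairwise.1 c.2)
    exact (List.pairwise_cons.1 h).2.imp fun h => h.ne
  · intro c d h
    exact Subtype.ext (Subtype.mk.inj h)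

instance : Fintype A.Chain := Fintype.ofFinite _

/-- `∏ Poin([D_i, D_{i+1}]; y)` over the consecutive entries of the list `[D₀, D₁, …]`. -/
def poinList : List A.Flat → ℤ[X]
  | [] => 1
  | [_] => 1
  | X :: Y :: l => A.poin X Y * poinList (Y :: l)

/-- The chain Poincaré polynomial, with `C₀ = V` and `C_{k+1} = 0` attached to the chain. -/
def poinChain (c : A.Chain) : ℤ[X] := A.poinList (⊥ :: c.1 ++ [⊤])

/-- The coarse flag Hilbert-Poincaré series, as a rational function in `t` over `ℤ[y]`. -/
def cfHP : RatFunc ℤ[X] :=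
  ∑ c : A.Chain, RatFunc.C (A.poinChain c) * (RatFunc.X / (1 - RatFunc.X)) ^ c.1.length

/-- `N ∈ ℤ[y][t]` is the numerator polynomial of `A`: `cfHP_A(y, t) = N(y, t) / (1 - t) ^ dim V`.
There is at most one such `N`. -/
def IsNumerator (N : ℤ[X][X]) : Prop :=
  A.cfHP = algebraMap ℤ[X][X] (RatFunc ℤ[X]) N / (1 - RatFunc.X) ^ Module.finrank ℝ V

end HyperplaneArrangement

/-! ### The braid arrangement -/

/-- The space of all `x ∈ ℝ^(n+1)` whose coordinates sum to `0`. -/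
abbrev BraidSpace (n : ℕ) : Submodule ℝ (Fin (n + 1) → ℝ) :=
  LinearMap.ker (∑ i, LinearMap.proj i : (Fin (n + 1) → ℝ) →ₗ[ℝ] ℝ)

/-- The linear form `x ↦ x_i - x_j`. -/
def braidForm (n : ℕ) (i j : Fin (n + 1)) : BraidSpace n →ₗ[ℝ] ℝ :=
  (LinearMap.proj (R := ℝ) (φ := fun _ : Fin (n + 1) => ℝ) i -
    LinearMap.proj (R := ℝ) (φ := fun _ : Fin (n + 1) => ℝ) j) ∘ₗ (BraidSpace n).subtype

/-- The hyperplane `x_i = x_j`. -/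
def braidHyperplane (n : ℕ) (i j : Fin (n + 1)) : Submodule ℝ (BraidSpace n) :=
  LinearMap.ker (braidForm n i j)

theorem mem_braidHyperplane {n : ℕ} {i j : Fin (n + 1)} {x : BraidSpace n} :
    x ∈ braidHyperplane n i j ↔ x.1 i = x.1 j := by
  simp [braidHyperplane, braidForm, sub_eq_zero]

theorem isCoatom_braidHyperplane {n : ℕ} {i j : Fin (n + 1)} (h : i < j) :
    IsCoatom (braidHyperplane n i j) := by
  refine LinearMap.isCoatom_ker_of_surjective (LinearMap.surjective ?_)
  intro h0
  have hv : (Pi.single i 1 - Pi.single j 1 : Fin (n + 1) → ℝ) ∈ BraidSpace n := by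
    simp [LinearMap.mem_ker]
  have h1 := LinearMap.congr_fun h0 ⟨_, hv⟩
  simp [braidForm, h.ne, h.ne'] at h1

/-- The braid arrangement, consisting of the hyperplanes `x_i = x_j` for `i < j`. -/
def braidArrangement (n : ℕ) : HyperplaneArrangement (BraidSpace n) where
  hyperplanes := {H | ∃ i j, i < j ∧ H = braidHyperplane n i j}
  finite := by
    refine (Set.finite_range
      (fun p : Fin (n + 1) × Fin (n + 1) => braidHyperplane n p.1 p.2)).subset ?_
    rintro H ⟨i, j, -, rfl⟩
    exact ⟨(i, j), rfl⟩
  isCoatom := by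
    rintro H ⟨i, j, h, rfl⟩
    exact isCoatom_braidHyperplane h
  essential := by
    refine le_antisymm ?_ bot_le
    intro x hx
    rw [Submodule.mem_sInf] at hx
    have h0 : ∀ i, x.1 i = x.1 0 := by
      intro i
      rcases eq_or_ne i 0 with rfl | hi
      · rfl
      · exact (mem_braidHyperplane.1
          (hx _ ⟨0, i, Fin.pos_iff_ne_zero.2 hi, rfl⟩)).symm
    have hs : ∑ i, x.1 i = 0 := by
      have h2 := LinearMap.mem_ker.1 x.2
      rwa [LinearMap.sum_apply] at h2
    rw [Finset.sum_congr rfl fun i _ => h0 i] at hs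
    have h00 : x.1 0 = 0 := by
      have h1 : ((n : ℝ) + 1) * x.1 0 = 0 := by simpa using hs
      exact (mul_eq_zero.1 h1).resolve_left (by positivity)
    rw [Submodule.mem_bot]
    ext i
    rw [h0 i, h00]
    rfl

end

/-! ### Permutation statistics

Positions and entries are counted from `0`. The one-line notation of `w` has the bars
`0, …, n - 1`; the bar `r` stands between the positions `r.castSucc` and `r.succ`. -/

/-- The number of descents `σ(i) > σ(i + 1)`. -/
def descentNumber {n : ℕ} (σ : Equiv.Perm (Fin n)) : ℕ :=
  (Finset.univ.filter fun i : Fin n => ∃ h : i.1 + 1 < n, σ ⟨i.1 + 1, h⟩ < σ i).card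

/-- In the set composition obtained from the one-line notation of `w` by keeping exactly the bars
in `S`, the block of the entry at position `p`: it consists of the entries `w q` such that
no bar of `S` stands between the positions `p` and `q`. -/
def block {n : ℕ} (w : Equiv.Perm (Fin (n + 1))) (S : Finset (Fin n)) (p : Fin (n + 1)) :
    Finset (Fin (n + 1)) :=
  (Finset.univ.filter fun q => ∀ r ∈ S, ¬ (min p q ≤ r.castSucc ∧ r.succ ≤ max p q)).image w

theorem block_nonempty {n : ℕ} (w : Equiv.Perm (Fin (n + 1))) (S : Finset (Fin n))
    (p : Fin (n + 1)) : (block w S p).Nonempty := by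
  refine ⟨w p, Finset.mem_image_of_mem w ?_⟩
  simp only [Finset.mem_filter, Finset.mem_univ, true_and, min_self, max_self]
  rintro r - ⟨h1, h2⟩
  exact absurd (h2.trans h1) (by simp)

/-- The bars that are still present right before step `i`, when the bars are deleted in the order
`σ 0, σ 1, …`. -/
def barsBefore {n : ℕ} (σ : Equiv.Perm (Fin n)) (i : Fin n) : Finset (Fin n) :=
  (Finset.univ.filter fun j => i ≤ j).image σ

/-- The number of steps `i` at which the two blocks `B | B'`, adjacent at the bar `σ i` that is
deleted in step `i`, come in order: `min B < min B'`. -/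
def ino {n : ℕ} (w : Equiv.Perm (Fin (n + 1))) (σ : Equiv.Perm (Fin n)) : ℕ :=
  (Finset.univ.filter fun i : Fin n =>
    (block w (barsBefore σ i) (σ i).castSucc).min' (block_nonempty _ _ _) <
      (block w (barsBefore σ i) (σ i).succ).min' (block_nonempty _ _ _)).card

/-!
Write `u = t / (1 - t)`. The lattice of flats of the braid arrangement is the lattice of set
partitions of `{0, …, n}` (`flatOrderIso`). Its interval polynomials factor: `Poin([s, t]; y)` is
the product, over the blocks of `t`, of `(1 + y) (1 + 2 y) ⋯ (1 + (m - 1) y)`, where `m` is the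
number of blocks of `s` in the given block (`poin_braidArrangement`). Indeed, expanding the product
gives a sum over increasing forests on the minima of the blocks of `s`, in which `y` counts edges.
Sorting the forests by their partition into trees (`sum_treePoly`) shows that the interval sums of
the signed number of forests vanish, so that this number is the Möbius function, and then that the
product is the Poincaré polynomial.

The same product is the generating function of the orderings of the blocks of `s` which refine a
given ordering of the blocks of `t`, by the number of blocks that are not left-to-right minima
(`sum_mergeWeight`). When adjacent blocks are merged from left to right, these are the merges which
come in order, as counted by `ino`. Since `cfHP` is a sum over chains of partitions which is
determined by a recursion on its first step (`chainSum`), this identity lifts `cfHP` to the sum over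
all chains of set compositions that start at a composition into singletons, that is, at a
permutation `w` (`sum_fiber_chainSum`). Such a chain deletes the bars of `w` in several rounds.

Finally, a deletion order `σ` is cut into rounds within which the bars are deleted from left to
right. A cut is forced at each descent and optional at each ascent. As `t = (1 - t) u` and
`1 = (1 - t) (u + 1)`, giving the weight `u` to each cut accounts for `t ^ des(σ)`, up to a factor
`1 - t` for each bar (`sum_perm_ino_descentNumber`). This is the denominator `(1 - t) ^ n`.
-/

/-! ### Weighted sums over chains -/

section ChainSum

variable {P Q K : Type*} [CommRing K] [PartialOrder P] [Fintype P] [OrderTop P]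
  [PartialOrder Q] [Fintype Q] [OrderTop Q]

open Classical in
/-- The sum over all chains `x < x₁ < ⋯ < x_k` (`k ≥ 0`) of
`u ^ k * p x x₁ * p x₁ x₂ * ⋯ * p x_k ⊤`, defined by recursion on the first step of the chain. -/
noncomputable def chainSum (p : P → P → K) (u : K) : P → K :=
  (wellFounded_gt (α := P)).fix fun x ih =>
    p x ⊤ + u * ∑ y : {y // x < y}, p x y * ih y y.2

open Classical in
theorem chainSum_eq (p : P → P → K) (u : K) (x : P) :
    chainSum p u x = p x ⊤ + u * ∑ y with x < y, p x y * chainSum p u y := by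
  rw [chainSum, WellFounded.fix_eq, ← chainSum]
  congr 2
  exact (Finset.sum_subtype (p := fun y => x < y) _ (by simp)
    (fun y => p x y * chainSum p u y)).symm

open Classical in
/-- If the weights of `P` push forward to those of `Q` along `f`, then so do the chain sums. -/
theorem sum_fiber_chainSum (f : P → Q) (hf : StrictMono f) (htop : f ⊤ = ⊤)
    (p : P → P → K) (q : Q → Q → K) (u : K)
    (h : ∀ a b', a ≤ f b' → ∑ b with f b = a ∧ b ≤ b', p b b' = q a (f b')) (a : Q) :
    ∑ b with f b = a, chainSum p u b = chainSum q u a := by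
  induction a using (wellFounded_gt (α := Q)).induction with
  | _ a ih =>
  rw [chainSum_eq q, Finset.sum_congr rfl fun b _ => chainSum_eq p u b, Finset.sum_add_distrib,
    ← Finset.mul_sum]
  congr 1
  · rw [← htop, ← h a ⊤ (by simp [htop])]
    simp
  congr 1
  calc ∑ b with f b = a, ∑ b' with b < b', p b b' * chainSum p u b'
      = ∑ b' with a < f b', ∑ b with f b = a ∧ b ≤ b', p b b' * chainSum p u b' := by
        refine Finset.sum_comm' fun b b' => ?_
        simp only [Finset.mem_filter, Finset.mem_univ, true_and]
        constructor
        · rintro ⟨rfl, hb⟩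
          exact ⟨⟨rfl, hb.le⟩, hf hb⟩
        · rintro ⟨⟨rfl, hb⟩, hb'⟩
          exact ⟨rfl, lt_of_le_of_ne hb (by rintro rfl; exact hb'.false)⟩
    _ = ∑ b' with a < f b', q a (f b') * chainSum p u b' := by
        refine Finset.sum_congr rfl fun b' hb' => ?_
        rw [← Finset.sum_mul, h a b' (Finset.mem_filter.1 hb').2.le]
    _ = ∑ a' with a < a', ∑ b' with f b' = a', q a (f b') * chainSum p u b' := by
        rw [Finset.sum_comm' (t' := Finset.univ.filter fun b' => a < f b') (s' := fun b' => {f b'})]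
        · simp
        · intro a' b'
          simp only [Finset.mem_filter, Finset.mem_univ, true_and, Finset.mem_singleton]
          constructor
          · rintro ⟨h1, rfl⟩
            exact ⟨rfl, h1⟩
          · rintro ⟨rfl, h1⟩
            exact ⟨h1, rfl⟩
    _ = ∑ a' with a < a', q a a' * chainSum q u a' := by
        refine Finset.sum_congr rfl fun a' ha' => ?_
        rw [← ih a' (Finset.mem_filter.1 ha').2, Finset.mul_sum]
        refine Finset.sum_congr rfl fun b' hb' => ?_
        rw [(Finset.mem_filter.1 hb').2]

end ChainSum

namespace HyperplaneArrangement

variable {V : Type*} [AddCommGroup V] [Module ℝ V] (A : HyperplaneArrangement V)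

/-- The chains of flats strictly above `x`. -/
abbrev ChainAbove (x : A.Flat) : Type _ := {c : List A.Flat // (x :: c).IsChain (· < ·)}

instance (x : A.Flat) : Finite (A.ChainAbove x) := by
  refine Finite.of_injective (β := A.Chain) (fun c => ⟨c.1, ?_⟩) fun c d h =>
    Subtype.ext (Subtype.mk.inj h)
  have h := List.isChain_iff_pairwise.1 c.2
  rw [List.pairwise_cons] at h
  rw [List.isChain_iff_pairwise, List.pairwise_cons]
  exact ⟨fun y hy => bot_le.trans_lt (h.1 y hy), h.2⟩

noncomputable instance (x : A.Flat) : Fintype (A.ChainAbove x) := Fintype.ofFinite _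

/-- A chain above `x` is empty or consists of a first flat `y > x` and a chain above `y`. -/
def chainAboveEquiv (x : A.Flat) :
    A.ChainAbove x ≃ Option (Σ y : {y : A.Flat // x < y}, A.ChainAbove y.1) where
  toFun
    | ⟨[], _⟩ => none
    | ⟨y :: c, h⟩ => some ⟨⟨y, (List.isChain_cons_cons.1 h).1⟩, ⟨c, (List.isChain_cons_cons.1 h).2⟩⟩
  invFun
    | none => ⟨[], List.isChain_singleton x⟩
    | some c => ⟨c.1.1 :: c.2.1, List.isChain_cons_cons.2 ⟨c.1.2, c.2.2⟩⟩
  left_inv c := by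
    rcases c with ⟨_ | ⟨y, c⟩, h⟩ <;> rfl
  right_inv c := by
    rcases c with _ | ⟨⟨y, h⟩, ⟨c, h'⟩⟩ <;> rfl

open Classical in
theorem sum_chainAbove {K : Type*} [CommRing K] (φ : ℤ[X] →+* K) (u : K) (x : A.Flat) :
    ∑ c : A.ChainAbove x, φ (A.poinList (x :: c.1 ++ [⊤])) * u ^ c.1.length =
      chainSum (fun x y => φ (A.poin x y)) u x := by
  induction x using (wellFounded_gt (α := A.Flat)).induction with
  | _ x ih =>
  rw [chainSum_eq, ← (A.chainAboveEquiv x).symm.sum_comp, Fintype.sum_option, Fintype.sum_sigma]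
  congr 1
  · simp [chainAboveEquiv, poinList]
  rw [Finset.mul_sum, Finset.sum_subtype (p := fun y => x < y) _ (by simp)]
  refine Finset.sum_congr rfl fun y _ => ?_
  rw [← ih y.1 y.2, Finset.mul_sum, Finset.mul_sum]
  refine Finset.sum_congr rfl fun c _ => ?_
  simp only [chainAboveEquiv, Equiv.coe_fn_symm_mk, List.cons_append, poinList, map_mul,
    List.length_cons, pow_succ]
  ring

theorem cfHP_eq_chainSum :
    A.cfHP = chainSum (fun x y => RatFunc.C (A.poin x y)) (RatFunc.X / (1 - RatFunc.X)) ⊥ := by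
  rw [← A.sum_chainAbove RatFunc.C, cfHP]
  exact Fintype.sum_equiv (Equiv.refl _) _ _ fun c => rfl

end HyperplaneArrangement

/-! ### Permutations adapted to a total preorder -/

/-- A set composition of `α`, that is, an ordered set partition, encoded as a total preorder: its
blocks are the classes of equivalent elements, and `le a b` means that the block of `a` is the
block of `b` or stands to the left of it. -/
@[ext] structure SetComposition (α : Type*) where
  le : α → α → Prop
  total : ∀ a b, le a b ∨ le b a
  trans : ∀ {a b c}, le a b → le b c → le a c

namespace SetComposition

variable {α β : Type*}

theorem refl (c : SetComposition α) (a : α) : c.le a a := (c.total a a).elim id id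

/-- Set compositions are ordered by coarsening: `c ≤ d` if `d` arises from `c` by merging runs of
adjacent blocks. -/
instance : PartialOrder (SetComposition α) :=
  PartialOrder.lift (fun c => c.le) fun _ _ h => SetComposition.ext h

/-- The top element is the composition with a single block. -/
instance : OrderTop (SetComposition α) where
  top := ⟨fun _ _ => True, fun _ _ => Or.inl trivial, fun _ _ => trivial⟩
  le_top _ := fun _ _ _ => trivial

instance [Finite α] : Finite (SetComposition α) :=
  Finite.of_injective (fun c => c.le) fun _ _ h => SetComposition.ext h

noncomputable instance [Finite α] : Fintype (SetComposition α) := Fintype.ofFinite _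

/-- The underlying set partition. -/
def ker (c : SetComposition α) : Setoid α where
  r a b := c.le a b ∧ c.le b a
  iseqv := ⟨fun a => ⟨c.refl a, c.refl a⟩, fun h => ⟨h.2, h.1⟩,
    fun h h' => ⟨c.trans h.1 h'.1, c.trans h'.2 h.2⟩⟩

theorem ker_def {c : SetComposition α} {a b : α} : c.ker a b ↔ c.le a b ∧ c.le b a := Iff.rfl

theorem ker_top : (⊤ : SetComposition α).ker = ⊤ :=
  Setoid.ext fun _ _ => ⟨fun _ => trivial, fun _ => ⟨trivial, trivial⟩⟩

theorem ker_strictMono : StrictMono (ker : SetComposition α → Setoid α) := by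
  intro c d h
  refine lt_of_le_of_ne (fun a b hab => ⟨h.le _ _ hab.1, h.le _ _ hab.2⟩) fun hk => h.not_ge ?_
  intro a b hab
  rcases c.total a b with h1 | h1
  · exact h1
  · have : d.ker a b := ⟨hab, h.le _ _ h1⟩
    rw [← hk] at this
    exact this.1

/-- The set composition of `α` induced from one of `β` along `f : α → β`. -/
def comap (c : SetComposition β) (f : α → β) : SetComposition α where
  le a b := c.le (f a) (f b)
  total _ _ := c.total _ _
  trans h h' := c.trans h h'

/-- The set composition whose blocks are the fibres of `q`, in the order prescribed by `e`. -/
def ofPerm {m : ℕ} (q : α → Fin m) (e : Equiv.Perm (Fin m)) : SetComposition α where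
  le a b := e (q a) ≤ e (q b)
  total _ _ := le_total _ _
  trans h h' := le_trans h h'

theorem ker_ofPerm {m : ℕ} (q : α → Fin m) (e : Equiv.Perm (Fin m)) :
    (ofPerm q e).ker = Setoid.ker q := by
  ext a b
  rw [Setoid.ker_def]
  exact ⟨fun h => e.injective (le_antisymm h.1 h.2), fun h => ⟨(congrArg e h).le,
    (congrArg e h).ge⟩⟩

theorem ofPerm_injective {m : ℕ} {q : α → Fin m} (hq : Function.Surjective q) :
    Function.Injective (ofPerm q) := by
  intro e e' h
  have key : ∀ i j, e i ≤ e j ↔ e' i ≤ e' j := by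
    intro i j
    obtain ⟨a, rfl⟩ := hq i
    obtain ⟨b, rfl⟩ := hq j
    exact iff_of_eq (congrFun (congrFun (congrArg SetComposition.le h) a) b)
  let f : Fin m ≃o Fin m := ⟨e.symm.trans e', fun {i j} => by
    have := key (e.symm i) (e.symm j)
    simpa using this.symm⟩
  have hf : f = OrderIso.refl _ := Subsingleton.elim _ _
  ext i
  have h2 := congrArg (fun g : Fin m ≃o Fin m => g (e i)) hf
  simp only [OrderIso.refl_apply] at h2
  rw [← h2]
  simp [f]

open Classical in
theorem exists_ofPerm_eq {m : ℕ} {q : α → Fin m} (hq : Function.Surjective q)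
    (c : SetComposition α) (hc : c.ker = Setoid.ker q) : ∃ e, ofPerm q e = c := by
  choose s hs using hq
  have hk : ∀ a b, (c.le a b ∧ c.le b a) ↔ q a = q b := fun a b => by
    rw [← Setoid.ker_def, ← hc]; rfl
  -- The rank of a block is the number of blocks strictly to its left.
  let r : Fin m → Fin m := fun i =>
    ⟨(Finset.univ.filter fun j => ¬ c.le (s i) (s j)).card, by
      refine (Finset.card_lt_univ_of_notMem (x := i) ?_).trans_eq (Fintype.card_fin m)
      simp [c.refl]⟩
  have hr : ∀ i j, ¬ c.le (s j) (s i) → r i < r j := by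
    intro i j hij
    have hij' := (c.total (s i) (s j)).resolve_right hij
    change (Finset.univ.filter fun k => ¬ c.le (s i) (s k)).card <
      (Finset.univ.filter fun k => ¬ c.le (s j) (s k)).card
    refine Finset.card_lt_card ⟨fun k => ?_, fun h => ?_⟩
    · simp only [Finset.mem_filter, Finset.mem_univ, true_and]
      exact fun h h' => h (c.trans hij' h')
    · have := h (x := i) (by simpa using hij)
      simp [c.refl] at this
  have hinj : Function.Injective r := by
    intro i j hij
    rw [← hs i, ← hs j, ← hk]
    constructor
    · by_contra h
      exact (hr _ _ h).ne' hij
    · by_contra h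
      exact (hr _ _ h).ne hij
  refine ⟨Equiv.ofBijective r (Finite.injective_iff_bijective.1 hinj), ?_⟩
  have hle : ∀ i j, r i ≤ r j ↔ c.le (s i) (s j) := by
    intro i j
    refine ⟨fun h => ?_, fun h => ?_⟩
    · by_contra h'
      exact (hr _ _ h').not_ge h
    · by_contra h'
      have h2 : ¬ c.le (s j) (s i) := fun h2 => by
        have := (hk _ _).1 ⟨h, h2⟩
        rw [hs, hs] at this
        exact h' (by rw [this])
      exact h' (hr _ _ h2).le
  have hs' : ∀ a, c.le a (s (q a)) ∧ c.le (s (q a)) a := fun a => (hk _ _).2 (hs _).symm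
  ext a b
  change r (q a) ≤ r (q b) ↔ _
  rw [hle]
  exact ⟨fun h => c.trans (hs' a).1 (c.trans h (hs' b).2),
    fun h => c.trans (hs' a).2 (c.trans h (hs' b).1)⟩

end SetComposition

/-- The permutation which sends the last element to `p` and all others, in the order given by `e`,
to the remaining values. -/
def insertLast {m : ℕ} (p : Fin (m + 1)) (e : Equiv.Perm (Fin m)) : Equiv.Perm (Fin (m + 1)) :=
  ((finSuccEquiv' (Fin.last m)).trans (Equiv.optionCongr e)).trans (finSuccEquiv' p).symm

@[simp] theorem insertLast_last {m : ℕ} (p : Fin (m + 1)) (e : Equiv.Perm (Fin m)) :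
    insertLast p e (Fin.last m) = p := by
  simp [insertLast]

@[simp] theorem insertLast_castSucc {m : ℕ} (p : Fin (m + 1)) (e : Equiv.Perm (Fin m))
    (i : Fin m) : insertLast p e i.castSucc = p.succAbove (e i) := by
  rw [← Fin.succAbove_last_apply, insertLast]
  simp only [Equiv.trans_apply, finSuccEquiv'_succAbove, Equiv.optionCongr_apply,
    Option.map_some, finSuccEquiv'_symm_some]

theorem insertLast_bijective (m : ℕ) : Function.Bijective
    fun x : Fin (m + 1) × Equiv.Perm (Fin m) => insertLast x.1 x.2 := by
  rw [Fintype.bijective_iff_injective_and_card]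
  constructor
  · rintro ⟨p, e⟩ ⟨p', e'⟩ h
    have h1 : p = p' := by simpa using congrArg (fun f => f (Fin.last m)) h
    subst h1
    congr 1
    ext i
    have := congrArg (fun f => f i.castSucc) h
    simp only [insertLast_castSucc] at this
    rw [Fin.succAbove_right_injective this]
  · simp [Fintype.card_perm, Nat.factorial_succ]

/-- If each label to the left of a label in `S` is in `S`, then the labels in `S` take exactly the
first `#S` positions. -/
theorem mem_iff_lt_card_of_isLower {m : ℕ} (e : Equiv.Perm (Fin m)) (S : Finset (Fin m))
    (h : ∀ i j, e i ≤ e j → j ∈ S → i ∈ S) (j : Fin m) : j ∈ S ↔ (e j).val < S.card := by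
  constructor
  · intro hj
    have h1 : Finset.Iic (e j) ⊆ S.map e.toEmbedding := by
      intro k hk
      rw [Finset.mem_map_equiv]
      exact h _ j (by simpa using hk) hj
    have := Finset.card_le_card h1
    rw [Fin.card_Iic, Finset.card_map] at this
    omega
  · intro hj
    by_contra hjS
    have h1 : S.map e.toEmbedding ⊆ Finset.Iio (e j) := by
      intro k hk
      rw [Finset.mem_map_equiv] at hk
      rw [Finset.mem_Iio]
      by_contra hk'
      exact hjS (h j _ (by simpa using hk') hk)
    have := Finset.card_le_card h1
    rw [Fin.card_Iio, Finset.card_map] at this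
    omega

theorem sum_interval_weight {K : Type*} [CommRing K] (y : K) {m A r : ℕ} (h : A + r ≤ m) :
    ∑ p : Fin (m + 1) with A ≤ p.val ∧ p.val ≤ A + r, (if A < p.val then y else 1) =
      1 + y * r := by
  rw [Finset.sum_filter, Fin.sum_univ_eq_sum_range
    (fun p => if A ≤ p ∧ p ≤ A + r then (if A < p then y else 1) else 0), ← Finset.sum_filter]
  have : (Finset.range (m + 1)).filter (fun p => A ≤ p ∧ p ≤ A + r) =
      insert A (Finset.Ioc A (A + r)) := by
    ext p
    simp only [Finset.mem_filter, Finset.mem_range, Finset.mem_insert, Finset.mem_Ioc]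
    omega
  rw [this, Finset.sum_insert (by simp), if_neg (lt_irrefl A),
    Finset.sum_congr rfl fun p hp => if_pos (Finset.mem_Ioc.1 hp).1]
  simp [mul_comm]

open Classical in
/-- The generating function, by the number of entries which are not left-to-right minima of their
block, of all orderings of `0, …, m - 1` which refine a given set composition. The last label can
be inserted at `r + 1` adjacent positions, where `r` is the number of smaller labels in its block,
and it becomes a left-to-right minimum for the first of them only. -/
theorem sum_perm_refining {K : Type*} [CommRing K] (y : K) (m : ℕ) (D : SetComposition (Fin m)) :
    ∑ e : Equiv.Perm (Fin m) with ∀ i j, e i ≤ e j → D.le i j,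
        ∏ i, (if ∃ j < i, D.ker j i ∧ e j < e i then y else 1) =
      ∏ i, (1 + y * (Finset.univ.filter fun j => j < i ∧ D.ker j i).card) := by
  induction m with
  | zero =>
    rw [Finset.sum_filter, Fintype.sum_unique]
    simp
  | succ m ih =>
  set D' := D.comap Fin.castSucc with hD'
  set A := (Finset.univ.filter fun j : Fin m => ¬ D.le (Fin.last m) j.castSucc).card with hA
  set r := (Finset.univ.filter fun j : Fin m => D.ker j.castSucc (Fin.last m)).card with hr
  have hsum : (Finset.univ.filter fun j : Fin m => D.le j.castSucc (Fin.last m)).card = A + r := by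
    rw [hA, hr, ← Finset.card_union_of_disjoint]
    · congr 1
      ext j
      simp only [Finset.mem_filter, Finset.mem_univ, true_and, Finset.mem_union,
        SetComposition.ker_def]
      have := D.total j.castSucc (Fin.last m)
      tauto
    · rw [Finset.disjoint_filter]
      exact fun j _ h h' => h h'.2
  have hAr : A + r ≤ m := by
    rw [← hsum]
    exact (Finset.card_le_univ _).trans_eq (Fintype.card_fin m)
  -- In an ordering refining `D'`, the labels strictly left of the block of the last label take the
  -- positions `< A`, and those of the block itself the positions from `A` to `A + r - 1`.
  have hlt : ∀ e : Equiv.Perm (Fin m), (∀ i j, e i ≤ e j → D'.le i j) →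
      ∀ j, ¬ D.le (Fin.last m) j.castSucc ↔ (e j).val < A := by
    intro e he j
    rw [hA, ← mem_iff_lt_card_of_isLower e]
    · simp
    · intro i j hij
      simp only [Finset.mem_filter, Finset.mem_univ, true_and]
      exact fun h h' => h (D.trans h' (he i j hij))
  have hle : ∀ e : Equiv.Perm (Fin m), (∀ i j, e i ≤ e j → D'.le i j) →
      ∀ j, D.le j.castSucc (Fin.last m) ↔ (e j).val < A + r := by
    intro e he j
    rw [← hsum, ← mem_iff_lt_card_of_isLower e]
    · simp
    · intro i j hij
      simp only [Finset.mem_filter, Finset.mem_univ, true_and]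
      exact fun h => D.trans (he i j hij) h
  have hcompat : ∀ (p : Fin (m + 1)) (e : Equiv.Perm (Fin m)),
      (∀ i j, insertLast p e i ≤ insertLast p e j → D.le i j) ↔
        (∀ i j, e i ≤ e j → D'.le i j) ∧ A ≤ p.val ∧ p.val ≤ A + r := by
    intro p e
    rw [Fin.forall_fin_succ']
    simp only [Fin.forall_fin_succ', insertLast_last, insertLast_castSucc,
      Fin.succAbove_le_succAbove_iff]
    have e1 : ∀ j, p.succAbove (e j) ≤ p ↔ (e j).val < p.val := fun j => by
      rw [(Fin.succAbove_ne p (e j)).le_iff_lt, Fin.succAbove_lt_iff_castSucc_lt, Fin.lt_def,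
        Fin.val_castSucc]
    have e2 : ∀ j, p ≤ p.succAbove (e j) ↔ p.val ≤ (e j).val := fun j => by
      rw [(Fin.succAbove_ne p (e j)).symm.le_iff_lt, Fin.lt_succAbove_iff_le_castSucc, Fin.le_def,
        Fin.val_castSucc]
    simp only [e1, e2]
    constructor
    · rintro h
      have he : ∀ i j, e i ≤ e j → D'.le i j := fun i j hij => (h.1 i).1 j hij
      refine ⟨he, ?_, ?_⟩
      · by_contra hp
        have hj := h.2.1 (e.symm ⟨p.val, by omega⟩) (by simp)
        exact (hlt e he _).2 (by simpa using hp) hj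
      · by_contra hp
        have hj := (h.1 (e.symm ⟨A + r, by omega⟩)).2 (by simpa using hp)
        rw [hle e he] at hj
        simp at hj
    · rintro ⟨he, h1, h2⟩
      refine ⟨fun i => ⟨fun j hij => he i j hij, fun hi => ?_⟩, fun j hj => ?_, fun _ => D.refl _⟩
      · rw [hle e he]
        omega
      · by_contra h
        rw [hlt e he] at h
        omega
  have hstat : ∀ (p : Fin (m + 1)) (e : Equiv.Perm (Fin m)), (∀ i j, e i ≤ e j → D'.le i j) →
      A ≤ p.val ∧ p.val ≤ A + r →
      ((∃ j < Fin.last m, D.ker j (Fin.last m) ∧ insertLast p e j < insertLast p e (Fin.last m)) ↔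
        A < p.val) := by
    intro p e he hp
    simp only [Fin.exists_fin_succ', lt_irrefl, false_and, or_false, insertLast_last,
      insertLast_castSucc, Fin.succAbove_lt_iff_castSucc_lt]
    constructor
    · rintro ⟨j, -, ⟨-, hk⟩, hj⟩
      rw [Fin.lt_def, Fin.val_castSucc] at hj
      have := mt (hlt e he j).2 (not_not.2 hk)
      omega
    · intro h
      refine ⟨e.symm ⟨A, by omega⟩, Fin.castSucc_lt_last _, ⟨?_, ?_⟩, ?_⟩
      · rw [hle e he]
        simp
        omega
      · by_contra h
        rw [hlt e he] at h
        simp at h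
      · rw [Fin.lt_def]
        simpa using h
  rw [Finset.sum_filter, ← (insertLast_bijective m).sum_comp, Fintype.sum_prod_type_right]
  simp only [hcompat]
  calc _ = ∑ e : Equiv.Perm (Fin m) with ∀ i j, e i ≤ e j → D'.le i j,
        (∏ i, (if ∃ j < i, D'.ker j i ∧ e j < e i then y else 1)) * (1 + y * r) := by
        rw [Finset.sum_filter]
        refine Finset.sum_congr rfl fun e _ => ?_
        split_ifs with he
        · rw [Finset.sum_congr rfl fun p _ => if_congr (and_iff_right he) rfl rfl,
            ← sum_interval_weight y hAr, ← Finset.sum_filter, Finset.mul_sum]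
          refine Finset.sum_congr rfl fun p hp => ?_
          rw [Fin.prod_univ_castSucc]
          congr 1
          · refine Finset.prod_congr rfl fun i _ => ?_
            congr 1
            simp only [Fin.exists_fin_succ', insertLast_castSucc, Fin.castSucc_lt_castSucc_iff,
              Fin.succAbove_lt_succAbove_iff, (Fin.castSucc_lt_last _).not_gt, false_and, or_false]
            rfl
          · simp only [hstat p e he (Finset.mem_filter.1 hp).2]
        · exact Finset.sum_eq_zero fun p _ => if_neg fun h => he h.1
    _ = _ := by
        rw [← Finset.sum_mul, ih, Fin.prod_univ_castSucc]
        congr 1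
        · refine Finset.prod_congr rfl fun i _ => ?_
          congr 3
          rw [← Finset.card_map Fin.castSuccEmb]
          congr 1
          ext j
          refine Fin.lastCases ?_ (fun j => ?_) j
          · simp [(Fin.castSucc_lt_last _).not_gt]
          · simp [hD', SetComposition.ker_def, SetComposition.comap]
        · rw [hr, ← Finset.card_map Fin.castSuccEmb]
          congr 4
          ext j
          refine Fin.lastCases ?_ (fun j => ?_) j
          · simp 
          · simp [Fin.castSucc_lt_last]

/-! ### Orderings of the blocks of a set partition -/

section BlockMin

variable {α : Type*} [LinearOrder α]

/-- `a` is the least element of its block in the set partition `s`. -/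
def IsBlockMin (s : Setoid α) (a : α) : Prop := ∀ b, s a b → a ≤ b

theorem IsBlockMin.eq_of_rel {s : Setoid α} {a b : α} (ha : IsBlockMin s a) (hb : IsBlockMin s b)
    (h : s a b) : a = b :=
  le_antisymm (ha b h) (hb a (s.symm h))

variable [Fintype α]

theorem exists_isBlockMin (s : Setoid α) (a : α) : ∃ b, s a b ∧ IsBlockMin s b := by
  classical
  obtain ⟨b, hb, hmin⟩ := Finset.exists_min_image (Finset.univ.filter fun b => s a b) id
    ⟨a, by simp⟩
  simp only [Finset.mem_filter, Finset.mem_univ, true_and, id] at hb hmin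
  exact ⟨b, hb, fun c hc => hmin c (s.trans hb hc)⟩

/-- The least element of the block of `a`. -/
noncomputable def blockMin (s : Setoid α) (a : α) : α := (exists_isBlockMin s a).choose

theorem rel_blockMin (s : Setoid α) (a : α) : s a (blockMin s a) :=
  (exists_isBlockMin s a).choose_spec.1

theorem isBlockMin_blockMin (s : Setoid α) (a : α) : IsBlockMin s (blockMin s a) :=
  (exists_isBlockMin s a).choose_spec.2

theorem blockMin_le (s : Setoid α) (a : α) : blockMin s a ≤ a :=
  isBlockMin_blockMin s a a (s.symm (rel_blockMin s a))

theorem blockMin_eq_iff {s : Setoid α} {a b : α} : blockMin s a = blockMin s b ↔ s a b := by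
  constructor
  · intro h
    refine s.trans (rel_blockMin s a) ?_
    rw [h]
    exact s.symm (rel_blockMin s b)
  · intro h
    exact (isBlockMin_blockMin s a).eq_of_rel (isBlockMin_blockMin s b)
      (s.trans (s.symm (rel_blockMin s a)) (s.trans h (rel_blockMin s b)))

theorem IsBlockMin.blockMin_eq {s : Setoid α} {a : α} (ha : IsBlockMin s a) : blockMin s a = a :=
  (isBlockMin_blockMin s a).eq_of_rel ha (s.symm (rel_blockMin s a))

open Classical in
/-- The minima of blocks of `s` which are smaller than `a` and lie in the block of `a` in the
coarser partition `t`. -/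
noncomputable def smallerMins (s t : Setoid α) (a : α) : Finset α :=
  Finset.univ.filter fun b => b < a ∧ IsBlockMin s b ∧ t b a

open Classical in
/-- The product over the blocks `B` of `t` of `(1 + y) (1 + 2 y) ⋯ (1 + (m - 1) y)`, where `B`
consists of `m` blocks of `s`. The `i`-th factor belongs to the `i + 1`-st block of `s` in `B`, if
these blocks are listed by increasing minima. -/
noncomputable def partitionPoin {K : Type*} [CommRing K] (y : K) (s t : Setoid α) : K :=
  ∏ a with IsBlockMin s a, (1 + y * (smallerMins s t a).card)

open Classical in
/-- The weight of the merging of blocks which leads from `c` to the coarser composition `d`, namely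
`y` to the number of blocks of `c` which are not left-to-right minima of their block of `d`, where
blocks are compared by their minima. -/
noncomputable def mergeWeight {K : Type*} [CommRing K] (y : K) (c d : SetComposition α) : K :=
  ∏ a with IsBlockMin c.ker a, if ∃ b < a, d.ker b a ∧ ¬ c.le a b then y else 1

open Classical in
/-- The orderings of the blocks of `s` which refine a given composition `d`, weighted by the merging
of blocks which leads to `d`, add up to a product. -/
theorem sum_mergeWeight {K : Type*} [CommRing K] (y : K) (s : Setoid α) (d : SetComposition α)
    (hs : s ≤ d.ker) :
    ∑ c with SetComposition.ker c = s ∧ c ≤ d, mergeWeight y c d = partitionPoin y s d.ker := by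
  -- The blocks are numbered by increasing minima.
  set M : Finset α := Finset.univ.filter (IsBlockMin s) with hM
  set o : Fin M.card ≃o M := M.orderIsoOfFin rfl
  have hM' : ∀ a, a ∈ M ↔ IsBlockMin s a := by simp [hM]
  let q : α → Fin M.card := fun a => o.symm ⟨blockMin s a, (hM' _).2 (isBlockMin_blockMin s a)⟩
  have hoq : ∀ a, (o (q a) : α) = blockMin s a := by simp [q]
  have hqo : ∀ i, q (o i) = i := by
    intro i
    apply o.injective
    apply Subtype.ext
    rw [hoq, ((hM' _).1 (o i).2).blockMin_eq]
  have hq : Function.Surjective q := fun i => ⟨o i, hqo i⟩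
  have hker : Setoid.ker q = s := by
    ext a b
    rw [Setoid.ker_def, ← blockMin_eq_iff, ← hoq, ← hoq]
    exact ⟨fun h => by rw [h], fun h => o.injective (Subtype.ext h)⟩
  have hd : ∀ a, d.ker a (o (q a)) := fun a => hs (by rw [hoq]; exact rel_blockMin s a)
  set D := d.comap fun i => (o i : α) with hD
  have hlt : ∀ i j, (o i : α) < o j ↔ i < j := fun i j => by simp
  have hprod : ∀ f : α → K, ∏ a with IsBlockMin s a, f a = ∏ i, f (o i) := by
    intro f
    rw [← hM, ← Finset.prod_coe_sort M, ← o.toEquiv.prod_comp]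
    rfl
  have hle : ∀ e : Equiv.Perm (Fin M.card),
      SetComposition.ofPerm q e ≤ d ↔ ∀ i j, e i ≤ e j → D.le i j := by
    intro e
    constructor
    · intro h i j hij
      refine h (o i) (o j) ?_
      simpa only [SetComposition.ofPerm, hqo] using hij
    · intro h a b hab
      exact d.trans (hd a).1 (d.trans (h _ _ hab) (hd b).2)
  trans ∑ e : Equiv.Perm (Fin M.card) with ∀ i j, e i ≤ e j → D.le i j,
        ∏ i, (if ∃ j < i, D.ker j i ∧ e j < e i then y else 1)
  · symm
    refine Finset.sum_bij (fun e _ => SetComposition.ofPerm q e) ?_ ?_ ?_ ?_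
    · intro e he
      simp only [Finset.mem_filter, Finset.mem_univ, true_and] at he ⊢
      exact ⟨(SetComposition.ker_ofPerm q e).trans hker, (hle e).2 he⟩
    · exact fun e _ e' _ h => SetComposition.ofPerm_injective hq h
    · intro c hc
      simp only [Finset.mem_filter, Finset.mem_univ, true_and] at hc
      obtain ⟨e, rfl⟩ := SetComposition.exists_ofPerm_eq hq c (hc.1.trans hker.symm)
      exact ⟨e, by simpa [← hle] using hc.2, rfl⟩
    · intro e _
      rw [mergeWeight, SetComposition.ker_ofPerm, hker, hprod]
      refine Finset.prod_congr rfl fun i _ => ?_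
      congr 1
      refine propext ⟨?_, ?_⟩
      · rintro ⟨j, hj, hk, he⟩
        refine ⟨o j, (hlt _ _).2 hj, hk, ?_⟩
        simpa only [SetComposition.ofPerm, hqo, not_le] using he
      · rintro ⟨b, hb, hk, he⟩
        refine ⟨q b, (hlt _ _).1 ?_, d.ker.trans (d.ker.symm (hd b)) hk, ?_⟩
        · rw [hoq]
          exact (blockMin_le s b).trans_lt hb
        · simpa only [SetComposition.ofPerm, hqo, not_le] using he
  · rw [sum_perm_refining, partitionPoin, hprod]
    refine Finset.prod_congr rfl fun i _ => ?_
    congr 3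
    rw [← Finset.card_map (o.toEquiv.toEmbedding.trans (Function.Embedding.subtype _))]
    congr 1
    ext a
    simp only [smallerMins, Finset.mem_map, Finset.mem_filter, Finset.mem_univ, true_and]
    constructor
    · rintro ⟨j, ⟨hj, hk⟩, rfl⟩
      exact ⟨(hlt _ _).2 hj, (hM' _).1 (o j).2, hk⟩
    · rintro ⟨h1, h2, h3⟩
      have ha : (o (q a) : α) = a := by rw [hoq, h2.blockMin_eq]
      refine ⟨q a, ⟨(hlt _ _).1 (by rwa [ha]), ?_⟩, ha⟩
      change d.ker (o (q a)) (o i)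
      rwa [ha]

end BlockMin

/-! ### Deletion of a single bar -/

section MergeTwo

variable {α K : Type*} [LinearOrder α] [Fintype α] [CommRing K]

theorem mergeWeight_self (y : K) (c : SetComposition α) : mergeWeight y c c = 1 := by
  classical
  refine Finset.prod_eq_one fun a ha => if_neg ?_
  rintro ⟨b, hb, hk, -⟩
  exact hb.not_ge ((Finset.mem_filter.1 ha).2 b (c.ker.symm hk))

/-- Let `c₁` arise from `c` by merging two adjacent blocks, those of `x` and `x'`. If the block of
`x` is the leftmost one in its block of `d`, then the weight of the merging from `c` to `d` is the
product of the weights of the mergings from `c` to `c₁` and from `c₁` to `d`. -/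
theorem mergeWeight_eq_mul (y : K) {c c₁ d : SetComposition α} {x x' : α} (h : c ≤ c₁)
    (hd : c₁ ≤ d) (hx : c₁.le x' x) (hxx' : c.le x x') (hx' : ¬ c.le x' x)
    (hmerge : ∀ a b, c₁.le a b → c.le a b ∨ c.ker a x' ∧ c.ker b x)
    (hleft : ∀ b, d.le x b → c.le x b) :
    mergeWeight y c d =
      (if blockMin c.ker x < blockMin c.ker x' then y else 1) * mergeWeight y c₁ d := by
  classical
  set p := blockMin c.ker x with hp
  set p' := blockMin c.ker x' with hp'
  have hpx : c.ker x p := rel_blockMin _ _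
  have hpx' : c.ker x' p' := rel_blockMin _ _
  have hpmin : IsBlockMin c.ker p := isBlockMin_blockMin _ _
  have hpmin' : IsBlockMin c.ker p' := isBlockMin_blockMin _ _
  have hle : ∀ {a b}, c.ker a b → c₁.ker a b := fun h' => ⟨h _ _ h'.1, h _ _ h'.2⟩
  have hpp₁ : c₁.ker p p' :=
    c₁.ker.trans (c₁.ker.symm (hle hpx)) (c₁.ker.trans ⟨h _ _ hxx', hx⟩ (hle hpx'))
  have hne : p ≠ p' := by
    intro he
    rw [hp, hp', blockMin_eq_iff] at he
    exact hx' he.2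
  have hmin₁ : ∀ a, IsBlockMin c₁.ker a → IsBlockMin c.ker a := fun a ha b hb => ha b (hle hb)
  have hp_of : ∀ a, IsBlockMin c.ker a → c.ker a x → a = p := fun a ha hax =>
    ha.eq_of_rel hpmin (c.ker.trans hax hpx)
  have hp'_of : ∀ a, IsBlockMin c.ker a → c.ker a x' → a = p' := fun a ha hax =>
    ha.eq_of_rel hpmin' (c.ker.trans hax hpx')
  have hp_le : ∀ b, c.ker b x → p ≤ b := fun b hb =>
    hpmin b (c.ker.trans (c.ker.symm hpx) (c.ker.symm hb))
  have hp'_le : ∀ b, c.ker b x' → p' ≤ b := fun b hb =>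
    hpmin' b (c.ker.trans (c.ker.symm hpx') (c.ker.symm hb))
  -- The larger one of the two minima is the only block minimum that gets lost.
  suffices key : ∀ l v, (∀ a, IsBlockMin c.ker a ↔ a = l ∨ IsBlockMin c₁.ker a) →
      ¬ IsBlockMin c₁.ker l →
      (if ∃ b < l, d.ker b l ∧ ¬ c.le l b then y else 1) = v →
      (∀ a b, IsBlockMin c₁.ker a → b < a → c₁.le a b → c.le a b) →
      mergeWeight y c d = v * mergeWeight y c₁ d by
    rcases hne.lt_or_gt with hlt | hlt
    · rw [if_pos hlt]
      have hnot : ¬ IsBlockMin c₁.ker p' := fun hm => hlt.not_ge (hm p (c₁.ker.symm hpp₁))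
      refine key p' y (fun a => ⟨fun ha => ?_, ?_⟩) hnot (if_pos ?_) ?_
      · refine or_iff_not_imp_left.2 fun hne' b hb => ?_
        rcases hmerge _ _ hb.1 with h1 | ⟨h1, -⟩
        · rcases hmerge _ _ hb.2 with h2 | ⟨h2, h3⟩
          · exact ha b ⟨h1, h2⟩
          · rw [hp_of a ha h3]
            exact hlt.le.trans (hp'_le b h2)
        · exact absurd (hp'_of a ha h1) hne'
      · rintro (rfl | ha)
        · exact hpmin'
        · exact hmin₁ a ha
      · refine ⟨p, hlt, ⟨hd _ _ hpp₁.1, hd _ _ hpp₁.2⟩, fun h' => hx' ?_⟩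
        exact c.trans hpx'.1 (c.trans h' hpx.2)
      · intro a b ha hb hab
        refine (hmerge _ _ hab).resolve_right fun h' => hnot ?_
        rwa [← hp'_of a (hmin₁ a ha) h'.1]
    · rw [if_neg hlt.not_gt]
      have hnot : ¬ IsBlockMin c₁.ker p := fun hm => hlt.not_ge (hm p' hpp₁)
      refine key p 1 (fun a => ⟨fun ha => ?_, ?_⟩) hnot (if_neg ?_) ?_
      · refine or_iff_not_imp_left.2 fun hne' b hb => ?_
        rcases hmerge _ _ hb.2 with h1 | ⟨-, h1⟩
        · rcases hmerge _ _ hb.1 with h2 | ⟨h2, h3⟩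
          · exact ha b ⟨h2, h1⟩
          · rw [hp'_of a ha h2]
            exact hlt.le.trans (hp_le b h3)
        · exact absurd (hp_of a ha h1) hne'
      · rintro (rfl | ha)
        · exact hpmin
        · exact hmin₁ a ha
      · rintro ⟨b, -, hk, hb⟩
        exact hb (c.trans hpx.2 (hleft b (d.trans (hd _ _ (h _ _ hpx.1)) hk.2)))
      · intro a b ha hb hab
        refine (hmerge _ _ hab).resolve_right fun h' => ?_
        rw [hp'_of a (hmin₁ a ha) h'.1] at hb
        exact (hb.trans hlt).not_ge (hp_le b h'.2)
  intro l v hl hl₁ hv hsame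
  have hS : Finset.univ.filter (IsBlockMin c.ker) =
      insert l (Finset.univ.filter (IsBlockMin c₁.ker)) := by
    ext a
    simp [hl]
  rw [mergeWeight, hS, Finset.prod_insert (by simpa using hl₁), hv, mergeWeight]
  congr 1
  refine Finset.prod_congr rfl fun a ha => ?_
  congr 1
  refine propext (exists_congr fun b => and_congr_right fun hb => and_congr_right fun _ =>
    not_congr ⟨h a b, hsame a b (Finset.mem_filter.1 ha).2 hb⟩)

end MergeTwo

/-! ### Words with bars -/

section Words

variable {n : ℕ} (w : Equiv.Perm (Fin (n + 1)))

/-- The set composition obtained from the one-line notation of `w` by keeping the bars in `R`: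
each bar to the left of `a` is also to the left of `b`. -/
def wordComp (R : Finset (Fin n)) : SetComposition (Fin (n + 1)) where
  le a b := ∀ r ∈ R, r.succ ≤ w.symm a → r.succ ≤ w.symm b
  total a b := (le_total (w.symm a) (w.symm b)).imp (fun h _ _ h' => h'.trans h)
    (fun h _ _ h' => h'.trans h)
  trans h h' := fun r hr ha => h' r hr (h r hr ha)

variable {w}

theorem wordComp_le {R : Finset (Fin n)} {a b : Fin (n + 1)} (h : w.symm a ≤ w.symm b) :
    (wordComp w R).le a b := fun _ _ h' => h'.trans h

theorem not_wordComp_le_succ {R : Finset (Fin n)} {r : Fin n} (hr : r ∈ R) :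
    ¬ (wordComp w R).le (w r.succ) (w r.castSucc) := by
  intro h
  have := h r hr
  simp [Fin.le_def] at this

theorem wordComp_le_succ {R : Finset (Fin n)} {r : Fin n} (hr : r ∉ R) :
    (wordComp w R).le (w r.succ) (w r.castSucc) := by
  intro r' hr' h
  have hne : r' ≠ r := fun h' => hr (h' ▸ hr')
  rw [Equiv.symm_apply_apply, Fin.le_def] at *
  simp only [Fin.val_succ, Fin.val_castSucc] at *
  have := fun h => hne (Fin.ext h)
  omega

theorem wordComp_le_wordComp {R R' : Finset (Fin n)} :
    wordComp w R ≤ wordComp w R' ↔ R' ⊆ R := by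
  constructor
  · intro h r hr
    by_contra hr'
    exact not_wordComp_le_succ hr (h _ _ (wordComp_le_succ hr'))
  · exact fun h a b hab r hr => hab r (h hr)

theorem wordComp_injective : Function.Injective (wordComp w) := fun _ _ h =>
  Finset.Subset.antisymm (wordComp_le_wordComp.1 h.ge) (wordComp_le_wordComp.1 h.le)

theorem wordComp_empty : wordComp w ∅ = ⊤ :=
  top_le_iff.1 fun _ _ _ r hr => absurd hr (Finset.notMem_empty r)

/-- Every composition that is coarser than one read off from `w` is read off from `w` itself. -/
theorem exists_wordComp_eq {R : Finset (Fin n)} {d : SetComposition (Fin (n + 1))}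
    (h : wordComp w R ≤ d) : ∃ R', wordComp w R' = d := by
  classical
  have hd : ∀ {a b}, w.symm a ≤ w.symm b → d.le a b := fun h' => h _ _ (wordComp_le h')
  refine ⟨Finset.univ.filter fun r : Fin n => ¬ d.le (w r.succ) (w r.castSucc), ?_⟩
  ext a b
  constructor
  · intro hab
    rcases le_total (w.symm a) (w.symm b) with h1 | h1
    · exact hd h1
    have key : ∀ p : Fin (n + 1), p ≤ w.symm a → d.le (w p) b := by
      intro p
      induction p using Fin.induction with
      | zero => exact fun _ => hd (by simp)
      | succ r ih =>
        intro hr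
        rcases le_or_gt r.succ (w.symm b) with h2 | h2
        · exact hd (by simpa using h2)
        · refine d.trans ?_ (ih ((Fin.castSucc_lt_succ (i := r)).le.trans hr))
          by_contra h3
          exact h2.not_ge (hab r (by simpa using h3) hr)
    simpa using key _ le_rfl
  · intro hab r hr hra
    by_contra hrb
    refine (Finset.mem_filter.1 hr).2 (d.trans (hd (by simpa using hra)) (d.trans hab (hd ?_)))
    rw [Equiv.symm_apply_apply, Fin.le_def]
    rw [not_le, Fin.lt_def, Fin.val_succ] at hrb
    rw [Fin.val_castSucc]
    omega

theorem mem_block_iff {R : Finset (Fin n)} {p : Fin (n + 1)} {b : Fin (n + 1)} :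
    b ∈ block w R p ↔ (wordComp w R).ker (w p) b := by
  simp only [block, Finset.mem_image, Finset.mem_filter, Finset.mem_univ, true_and,
    SetComposition.ker_def, wordComp, Equiv.symm_apply_apply]
  have hlc : ∀ (x : Fin (n + 1)) (r : Fin n), x ≤ r.castSucc ↔ ¬ r.succ ≤ x := fun x r => by
    rw [not_le, Fin.le_def, Fin.lt_def, Fin.val_succ, Fin.val_castSucc, Nat.lt_succ_iff]
  constructor
  · rintro ⟨q, hq, rfl⟩
    simp only [Equiv.symm_apply_apply]
    refine ⟨fun r hr h => ?_, fun r hr h => ?_⟩ <;>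
    · by_contra h'
      exact hq r hr ⟨by simp [hlc, h'], by simp [h]⟩
  · rintro ⟨h1, h2⟩
    refine ⟨w.symm b, fun r hr h => ?_, by simp⟩
    have h1 := h1 r hr
    have h2 := h2 r hr
    rw [hlc, le_min_iff, le_max_iff] at h
    tauto

theorem min'_block {R : Finset (Fin n)} {p : Fin (n + 1)} :
    (block w R p).min' (block_nonempty w R p) = blockMin (wordComp w R).ker (w p) := by
  refine le_antisymm (Finset.min'_le _ _ (mem_block_iff.2 (rel_blockMin _ _))) ?_
  refine Finset.le_min' _ _ _ fun b hb => ?_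
  rw [mem_block_iff] at hb
  rw [blockMin_eq_iff.2 hb]
  exact blockMin_le _ b

variable {K : Type*} [CommRing K] (y u : K) (w)

/-- The weight of the deletion of the bar `r` from the set `R` of bars: `y` if the blocks at `r`
come in order, and `1` otherwise. -/
def deletionWeight (R : Finset (Fin n)) (r : Fin n) : K :=
  if (block w R r.castSucc).min' (block_nonempty _ _ _) <
    (block w R r.succ).min' (block_nonempty _ _ _) then y else 1

variable {w}

/-- When a set of bars is deleted, its leftmost bar can be deleted ahead of the others. -/
theorem mergeWeight_wordComp {R R' : Finset (Fin n)} {r : Fin n} (hr : r ∈ R)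
    (hR' : R' ⊆ R.erase r) (hleft : ∀ i ∈ R, i < r → i ∈ R') :
    mergeWeight y (wordComp w R) (wordComp w R') =
      deletionWeight w y R r * mergeWeight y (wordComp w (R.erase r)) (wordComp w R') := by
  rw [deletionWeight, min'_block, min'_block]
  have hsucc : ∀ {x : Fin (n + 1)} {i : Fin n}, i.succ ≤ x ↔ i.val < x.val := fun {x i} => by
    rw [Fin.le_def, Fin.val_succ, Nat.succ_le_iff]
  refine mergeWeight_eq_mul y (wordComp_le_wordComp.2 (Finset.erase_subset _ _))
    (wordComp_le_wordComp.2 hR') (wordComp_le_succ (by simp))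
    (wordComp_le (by simpa using (Fin.castSucc_lt_succ (i := r)).le))
    (not_wordComp_le_succ hr) ?_ ?_
  · intro a b hab
    refine or_iff_not_imp_left.2 fun h => ?_
    simp only [wordComp, not_forall] at h
    obtain ⟨i, hi, hia, hib⟩ := h
    have hir : i = r := by
      by_contra hne
      exact hib (hab i (Finset.mem_erase.2 ⟨hne, hi⟩) hia)
    subst hir
    rw [hsucc] at hia hib
    have hab' : ∀ j ∈ R, j ≠ i → j.val < (w.symm a).val → j.val < (w.symm b).val :=
      fun j hj hne => by simpa only [hsucc] using hab j (Finset.mem_erase.2 ⟨hne, hj⟩)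
    refine ⟨⟨fun j hj h1 => ?_, wordComp_le ?_⟩, ⟨wordComp_le ?_, fun j hj h1 => ?_⟩⟩
    · rw [hsucc] at h1 ⊢
      rw [Equiv.symm_apply_apply, Fin.val_succ]
      by_cases hne : j = i
      · omega
      · have := hab' j hj hne h1
        omega
    · rw [Equiv.symm_apply_apply, hsucc]
      exact hia
    · rw [Equiv.symm_apply_apply, Fin.le_def, Fin.val_castSucc]
      omega
    · rw [hsucc] at h1 ⊢
      rw [Equiv.symm_apply_apply, Fin.val_castSucc] at h1
      exact hab' j hj (fun hne => by omega) (by omega)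
  · intro b hb i hi h1
    refine hb i (hleft i hi ?_) h1
    rw [hsucc, Equiv.symm_apply_apply, Fin.val_castSucc] at h1
    exact h1

end Words

/-! ### Deletion orders of the bars -/

section DeletionOrders

variable {n : ℕ} (w : Equiv.Perm (Fin (n + 1))) {K : Type*} [CommRing K] (y u t : K)

/-- The sum over all chains `R ⊃ R₁ ⊃ ⋯ ⊃ R_k` (`k ≥ 0`) of sets of bars, where `R_k` may be
empty, of `u ^ k` times the weights of the rounds which delete the bars of `R \ R₁`, `R₁ \ R₂`, …
and finally those of `R_k`. -/
noncomputable def roundSum (R : Finset (Fin n)) : K :=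
  chainSum (mergeWeight y) u (wordComp w R)

/-- The continuation of `roundSum` after a round which leaves the bars in `R`: either the chain of
sets of bars goes on with `R`, or this was the final round, which leaves no bars. -/
noncomputable def afterRound (R : Finset (Fin n)) : K :=
  u * roundSum w y u R + if R = ∅ then 1 else 0

/-- The continuation of `roundSum` in the middle of a round, in which bars to the right of `b`
may still be deleted from `R`. -/
noncomputable def midRound (R : Finset (Fin n)) (b : Fin n) : K :=
  ∑ R' ∈ R.powerset with ∀ r ∈ R, r ≤ b → r ∈ R',
    mergeWeight y (wordComp w R) (wordComp w R') * afterRound w y u R'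

theorem roundSum_eq (R : Finset (Fin n)) :
    roundSum w y u R = mergeWeight y (wordComp w R) (wordComp w ∅) +
      u * ∑ R' ∈ R.ssubsets, mergeWeight y (wordComp w R) (wordComp w R') * roundSum w y u R' := by
  classical
  rw [roundSum, chainSum_eq, wordComp_empty]
  congr 2
  symm
  refine Finset.sum_bij (fun R' _ => wordComp w R') ?_ ?_ ?_ ?_
  · intro R' hR'
    rw [Finset.mem_ssubsets] at hR'
    simp only [Finset.mem_filter, Finset.mem_univ, true_and]
    exact lt_of_le_of_ne (wordComp_le_wordComp.2 hR'.subset)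
      fun h => hR'.ne (wordComp_injective h).symm
  · exact fun _ _ _ _ h => wordComp_injective h
  · intro d hd
    simp only [Finset.mem_filter, Finset.mem_univ, true_and] at hd
    obtain ⟨R', rfl⟩ := exists_wordComp_eq hd.le
    refine ⟨R', Finset.mem_ssubsets.2 ?_, rfl⟩
    exact lt_of_le_of_ne (wordComp_le_wordComp.1 hd.le) fun h => hd.ne (by rw [h])
  · exact fun _ _ => rfl

theorem roundSum_empty : roundSum w y u ∅ = 1 := by
  have h : (∅ : Finset (Fin n)).ssubsets = ∅ := by
    ext R
    simp
  rw [roundSum_eq, mergeWeight_self, h, Finset.sum_empty, mul_zero, add_zero]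

theorem roundSum_eq_sum_afterRound {R : Finset (Fin n)} (hR : R.Nonempty) :
    roundSum w y u R = ∑ R' ∈ R.ssubsets,
      mergeWeight y (wordComp w R) (wordComp w R') * afterRound w y u R' := by
  rw [roundSum_eq, Finset.mul_sum]
  simp only [afterRound, mul_add, Finset.sum_add_distrib, mul_ite, mul_one, mul_zero]
  rw [Finset.sum_ite_eq' R.ssubsets ∅, if_pos (Finset.empty_mem_ssubsets hR), add_comm]
  congr 1
  exact Finset.sum_congr rfl fun R' _ => by ring

/-- Rounds are sorted by the leftmost bar which they delete. -/
theorem sum_afterRound_eq (R : Finset (Fin n)) (p : Fin n → Prop) [DecidablePred p]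
    (hp : ∀ i j, i ≤ j → p j → p i) :
    ∑ R' ∈ R.ssubsets with ∀ r ∈ R, p r → r ∈ R',
        mergeWeight y (wordComp w R) (wordComp w R') * afterRound w y u R' =
      ∑ r ∈ R with ¬ p r, deletionWeight w y R r * midRound w y u (R.erase r) r := by
  simp only [midRound, Finset.mul_sum]
  rw [Finset.sum_sigma']
  symm
  refine Finset.sum_bij (fun x _ => x.2) ?_ ?_ ?_ ?_
  · rintro ⟨r, R'⟩ h
    simp only [Finset.mem_sigma, Finset.mem_filter, Finset.mem_powerset, Finset.mem_ssubsets,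
      Finset.mem_erase] at h ⊢
    obtain ⟨⟨hr, hpr⟩, hR', hlow⟩ := h
    refine ⟨hR'.trans_ssubset (Finset.erase_ssubset hr), fun i hi hpi => ?_⟩
    have hir : i < r := by
      by_contra h
      exact hpr (hp _ _ (not_lt.1 h) hpi)
    exact hlow i ⟨hir.ne, hi⟩ hir.le
  · rintro ⟨r, R'⟩ h ⟨r₁, R₁⟩ h₁ (rfl : R' = R₁)
    simp only [Finset.mem_sigma, Finset.mem_filter, Finset.mem_powerset,
      Finset.mem_erase] at h h₁
    have key : ∀ {a b}, a ∈ R → R' ⊆ R.erase a →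
        (∀ i, i ≠ b ∧ i ∈ R → i ≤ b → i ∈ R') → b ≤ a := by
      intro a b ha hsub hlow
      by_contra hab
      rw [not_le] at hab
      exact Finset.notMem_erase a R (hsub (hlow a ⟨hab.ne, ha⟩ hab.le))
    have : r = r₁ := le_antisymm (key h₁.1.1 h₁.2.1 h.2.2) (key h.1.1 h.2.1 h₁.2.2)
    rw [this]
  · intro R' h
    simp only [Finset.mem_filter, Finset.mem_ssubsets] at h
    have hne : (R \ R').Nonempty := Finset.sdiff_nonempty.2 h.1.not_subset
    have hmem := Finset.min'_mem _ hne
    have hmin := fun i hi => Finset.min'_le (R \ R') i hi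
    set r := (R \ R').min' hne
    rw [Finset.mem_sdiff] at hmem
    refine ⟨⟨r, R'⟩, ?_, rfl⟩
    simp only [Finset.mem_sigma, Finset.mem_filter, Finset.mem_powerset, Finset.mem_erase]
    refine ⟨⟨hmem.1, fun hpr => hmem.2 (h.2 r hmem.1 hpr)⟩,
      Finset.subset_erase.2 ⟨h.1.subset, hmem.2⟩, fun i hi hir => ?_⟩
    by_contra hiR'
    exact hi.1 (le_antisymm hir (hmin i (Finset.mem_sdiff.2 ⟨hi.2, hiR'⟩)))
  · rintro ⟨r, R'⟩ h
    simp only [Finset.mem_sigma, Finset.mem_filter, Finset.mem_powerset,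
      Finset.mem_erase] at h
    rw [mergeWeight_wordComp y h.1.1 h.2.1 fun i hi hir => h.2.2 i ⟨hir.ne, hi⟩ hir.le, mul_assoc]

theorem roundSum_eq_sum_midRound {R : Finset (Fin n)} (hR : R.Nonempty) :
    roundSum w y u R = ∑ r ∈ R, deletionWeight w y R r * midRound w y u (R.erase r) r := by
  have h := sum_afterRound_eq w y u R (fun _ => False) fun _ _ _ h => h
  simp only [not_false_eq_true, Finset.filter_true, false_imp_iff, implies_true] at h
  rw [roundSum_eq_sum_afterRound w y u hR, h]

theorem midRound_eq_afterRound_add (R : Finset (Fin n)) (b : Fin n) :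
    midRound w y u R b = afterRound w y u R +
      ∑ r ∈ R with b < r, deletionWeight w y R r * midRound w y u (R.erase r) r := by
  have h := sum_afterRound_eq w y u R (· ≤ b) fun i j hij hj => hij.trans hj
  simp only [not_le] at h
  rw [← h, midRound]
  have : (R.powerset.filter fun R' => ∀ r ∈ R, r ≤ b → r ∈ R') =
      insert R (R.ssubsets.filter fun R' => ∀ r ∈ R, r ≤ b → r ∈ R') := by
    ext R'
    simp only [Finset.mem_filter, Finset.mem_powerset, Finset.mem_insert, Finset.mem_ssubsets]
    constructor
    · rintro ⟨h1, h2⟩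
      exact (eq_or_ssubset_of_subset h1).imp_right fun h => ⟨h, h2⟩
    · rintro (rfl | ⟨h1, h2⟩)
      · exact ⟨subset_rfl, fun r hr _ => hr⟩
      · exact ⟨h1.subset, h2⟩
  rw [this, Finset.sum_insert (by simp), mergeWeight_self, one_mul]

theorem midRound_empty (b : Fin n) : midRound w y u ∅ b = u + 1 := by
  rw [midRound_eq_afterRound_add, afterRound, roundSum_empty]
  simp

/-- After the deletion of `b`, the next bar to be deleted either starts a new round, or it continues
the current one, which requires that it stands to the right of `b`. -/
theorem midRound_eq {R : Finset (Fin n)} (hR : R.Nonempty) (b : Fin n) :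
    midRound w y u R b = ∑ r ∈ R, (u + if b < r then 1 else 0) *
      (deletionWeight w y R r * midRound w y u (R.erase r) r) := by
  rw [midRound_eq_afterRound_add, afterRound, if_neg hR.ne_empty, add_zero,
    roundSum_eq_sum_midRound w y u hR, Finset.mul_sum, Finset.sum_filter, ← Finset.sum_add_distrib]
  refine Finset.sum_congr rfl fun r _ => ?_
  split_ifs <;> ring

/-- The sequences of length `k` with set of entries `R`. For `k = #R` these are the orderings
of `R`. -/
def orderings (k : ℕ) (R : Finset (Fin n)) : Finset (Fin k → Fin n) :=
  Finset.univ.filter fun f => Finset.univ.image f = R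

/-- The weight of the deletion of the bars `f 0, f 1, …` in this order. -/
def orderWeight {k : ℕ} (f : Fin k → Fin n) : K :=
  (∏ i : Fin k, deletionWeight w y ((Finset.univ.filter fun j => i ≤ j).image f) (f i)) *
    t ^ (Finset.univ.filter fun i : Fin k => ∃ h : i.1 + 1 < k, f ⟨i.1 + 1, h⟩ < f i).card

/-- The factor `t` for a descent from `b` to the first entry of `f`. -/
def firstDescent {k : ℕ} (b : Fin n) (f : Fin k → Fin n) : K :=
  if ∃ h : 0 < k, f ⟨0, h⟩ < b then t else 1

theorem sum_orderings_succ {k : ℕ} {R : Finset (Fin n)} (hR : R.card = k + 1)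
    (G : (Fin (k + 1) → Fin n) → K) :
    ∑ f ∈ orderings (k + 1) R, G f =
      ∑ r ∈ R, ∑ f ∈ orderings k (R.erase r), G (Fin.cons r f) := by
  have himage : ∀ (r : Fin n) (f : Fin k → Fin n),
      Finset.univ.image (Fin.cons r f : Fin (k + 1) → Fin n) = insert r (Finset.univ.image f) := by
    intro r f
    ext x
    simp [Fin.exists_fin_succ, eq_comm]
  rw [Finset.sum_sigma']
  symm
  refine Finset.sum_bij (fun x _ => (Fin.cons x.1 x.2 : Fin (k + 1) → Fin n)) ?_ ?_ ?_ ?_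
  · rintro ⟨r, f⟩ h
    simp only [Finset.mem_sigma, orderings, Finset.mem_filter, Finset.mem_univ, true_and] at h ⊢
    rw [himage, h.2, Finset.insert_erase h.1]
  · rintro ⟨r, f⟩ _ ⟨r₁, f₁⟩ _ h
    obtain ⟨rfl, rfl⟩ := Fin.cons_injective2 h
    rfl
  · intro f hf
    simp only [orderings, Finset.mem_filter, Finset.mem_univ, true_and] at hf
    refine ⟨⟨f 0, Fin.tail f⟩, ?_, Fin.cons_self_tail f⟩
    simp only [Finset.mem_sigma, orderings, Finset.mem_filter, Finset.mem_univ, true_and]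
    have h1 : insert (f 0) (Finset.univ.image (Fin.tail f)) = R := by
      rw [← himage, Fin.cons_self_tail, hf]
    refine ⟨by rw [← h1]; exact Finset.mem_insert_self _ _, ?_⟩
    rw [← h1, Finset.erase_insert]
    intro h2
    rw [Finset.insert_eq_of_mem h2] at h1
    have h3 : (Finset.univ.image (Fin.tail f)).card ≤ k :=
      Finset.card_image_le.trans_eq (by simp)
    rw [h1, hR] at h3
    omega
  · exact fun _ _ => rfl

theorem orderWeight_cons {k : ℕ} {R : Finset (Fin n)} {r : Fin n} (hr : r ∈ R)
    {f : Fin k → Fin n} (hf : f ∈ orderings k (R.erase r)) :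
    orderWeight w y t (Fin.cons r f : Fin (k + 1) → Fin n) =
      deletionWeight w y R r * (orderWeight w y t f * firstDescent t r f) := by
  simp only [orderings, Finset.mem_filter, Finset.mem_univ, true_and] at hf
  have h0 : (Finset.univ.filter fun j : Fin (k + 1) => 0 ≤ j).image
      (Fin.cons r f : Fin (k + 1) → Fin n) = R := by
    rw [← Finset.insert_erase hr, ← hf]
    ext x
    simp [Fin.exists_fin_succ, eq_comm]
  have h1 : ∀ i : Fin k, (Finset.univ.filter fun j : Fin (k + 1) => i.succ ≤ j).image
      (Fin.cons r f : Fin (k + 1) → Fin n) = (Finset.univ.filter fun j => i ≤ j).image f := by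
    intro i
    ext x
    simp [Fin.exists_fin_succ]
  rw [orderWeight, Fin.prod_univ_succ, h0]
  simp only [h1, Fin.cons_zero, Fin.cons_succ]
  rw [Fin.card_filter_univ_succ, orderWeight, firstDescent]
  have h2 : ((∃ h : (0 : Fin (k + 1)).1 + 1 < k + 1,
      (Fin.cons r f : Fin (k + 1) → Fin n) ⟨(0 : Fin (k + 1)).1 + 1, h⟩ < r)) ↔
      ∃ h : 0 < k, f ⟨0, h⟩ < r := by
    constructor
    · rintro ⟨h, h'⟩
      exact ⟨by simpa using h, h'⟩
    · rintro ⟨h, h'⟩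
      exact ⟨by simpa using h, h'⟩
  have h3 : (Finset.univ.filter fun i : Fin k => ∃ h : i.succ.1 + 1 < k + 1,
      (Fin.cons r f : Fin (k + 1) → Fin n) ⟨i.succ.1 + 1, h⟩ <
        (Fin.cons r f : Fin (k + 1) → Fin n) i.succ) =
      Finset.univ.filter fun i : Fin k => ∃ h : i.1 + 1 < k, f ⟨i.1 + 1, h⟩ < f i := by
    ext i
    simp only [Finset.mem_filter, Finset.mem_univ, true_and, Fin.cons_succ]
    constructor
    · rintro ⟨h, h'⟩
      exact ⟨by simpa using h, h'⟩
    · rintro ⟨h, h'⟩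
      exact ⟨by simpa using h, h'⟩
  rw [h3]
  simp only [Fin.cons_zero, h2]
  split_ifs <;> ring

variable {t u}

/-- Each step of a deletion order contributes `1 - t` times the sum of `u`, for the start of a new
round, and of `1` for a continuation of the current round, if it is possible. -/
theorem sum_orderings_mul_firstDescent (hu : (1 - t) * u = t) (k : ℕ)
    (R : Finset (Fin n)) (hR : R.card = k) (b : Fin n) (hb : b ∉ R) :
    ∑ f ∈ orderings k R, orderWeight w y t f * firstDescent t b f =
      (1 - t) ^ (k + 1) * midRound w y u R b := by
  induction k generalizing R b with
  | zero =>
    rw [Finset.card_eq_zero] at hR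
    subst hR
    rw [midRound_empty]
    have : (1 - t) * (u + 1) = 1 := by
      rw [mul_add, hu]
      ring
    simp [orderings, orderWeight, firstDescent, this]
  | succ k ih =>
    rw [sum_orderings_succ hR, midRound_eq w y u (Finset.card_pos.1 (by omega)), Finset.mul_sum]
    refine Finset.sum_congr rfl fun r hr => ?_
    have hstep : ∀ f ∈ orderings k (R.erase r),
        orderWeight w y t (Fin.cons r f : Fin (k + 1) → Fin n) *
            firstDescent t b (Fin.cons r f : Fin (k + 1) → Fin n) =
          ((1 - t) * (u + if b < r then 1 else 0)) * deletionWeight w y R r *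
            (orderWeight w y t f * firstDescent t r f) := by
      intro f hf
      have h1 : firstDescent t b (Fin.cons r f : Fin (k + 1) → Fin n) =
          (1 - t) * (u + if b < r then 1 else 0) := by
        have hne : b ≠ r := fun h => hb (h ▸ hr)
        have h2 : (∃ h : 0 < k + 1, (Fin.cons r f : Fin (k + 1) → Fin n) ⟨0, h⟩ < b) ↔ r < b :=
          ⟨fun h => h.2, fun h => ⟨k.succ_pos, h⟩⟩
        rw [firstDescent]
        simp only [h2]
        rcases hne.lt_or_gt with h | h
        · rw [if_neg h.not_gt, if_pos h, mul_add, hu]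
          ring
        · rw [if_pos h, if_neg h.not_gt, add_zero, hu]
      rw [orderWeight_cons w y t hr hf, h1]
      ring
    rw [Finset.sum_congr rfl hstep, ← Finset.mul_sum,
      ih _ (by rw [Finset.card_erase_of_mem hr, hR]; rfl) r (Finset.notMem_erase _ _)]
    ring

theorem sum_orderings (hu : (1 - t) * u = t) (k : ℕ) (R : Finset (Fin n)) (hR : R.card = k) :
    ∑ f ∈ orderings k R, orderWeight w y t f = (1 - t) ^ k * roundSum w y u R := by
  cases k with
  | zero =>
    rw [Finset.card_eq_zero] at hR
    subst hR
    rw [roundSum_empty]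
    simp [orderings, orderWeight]
  | succ k =>
    rw [sum_orderings_succ hR, roundSum_eq_sum_midRound w y u (Finset.card_pos.1 (by omega)),
      Finset.mul_sum]
    refine Finset.sum_congr rfl fun r hr => ?_
    rw [Finset.sum_congr rfl fun f hf => orderWeight_cons w y t hr hf, ← Finset.mul_sum,
      sum_orderings_mul_firstDescent w y hu k _ (by rw [Finset.card_erase_of_mem hr, hR]; rfl) r
        (Finset.notMem_erase _ _)]
    ring

theorem sum_perm_ino_descentNumber (hu : (1 - t) * u = t) :
    ∑ σ : Equiv.Perm (Fin n), y ^ ino w σ * t ^ descentNumber σ =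
      (1 - t) ^ n * roundSum w y u Finset.univ := by
  rw [← sum_orderings w y hu n Finset.univ (by simp)]
  refine Finset.sum_bij (fun σ _ => σ) ?_ ?_ ?_ ?_
  · intro σ _
    simp [orderings]
  · exact fun σ _ σ' _ h => Equiv.coe_fn_injective h
  · intro f hf
    simp only [orderings, Finset.mem_filter, Finset.mem_univ, true_and] at hf
    have hs : Function.Surjective f := fun x => by
      simpa using (hf.symm ▸ Finset.mem_univ x : x ∈ Finset.univ.image f)
    exact ⟨Equiv.ofBijective f (Finite.surjective_iff_bijective.1 hs), Finset.mem_univ _, rfl⟩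
  · intro σ _
    simp only [orderWeight, deletionWeight, Finset.prod_ite, Finset.prod_const,
      one_pow, mul_one]
    rfl

end DeletionOrders

/-! ### Increasing forests and the Möbius function of a partition lattice -/

section Forests

variable {N : ℕ} {K : Type*} [CommRing K]

theorem rel_of_mem_smallerMins {s t : Setoid (Fin N)} {a b : Fin N} (h : b ∈ smallerMins s t a) :
    t b a := by
  simp only [smallerMins, Finset.mem_filter] at h
  exact h.2.2.2

theorem lt_of_mem_smallerMins {s t : Setoid (Fin N)} {a b : Fin N} (h : b ∈ smallerMins s t a) :
    b < a := by
  simp only [smallerMins, Finset.mem_filter] at h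
  exact h.2.1

theorem isBlockMin_of_mem_smallerMins {s t : Setoid (Fin N)} {a b : Fin N}
    (h : b ∈ smallerMins s t a) : IsBlockMin s b := by
  simp only [smallerMins, Finset.mem_filter] at h
  exact h.2.2.1

open Classical in
/-- The possible parents of `a` in an increasing forest on the minima of blocks of `s`, all of whose
trees lie in blocks of `t`. The roots, and all elements which are not block minima, are their own
parents. -/
noncomputable def parents (s t : Setoid (Fin N)) (a : Fin N) : Finset (Fin N) :=
  if IsBlockMin s a then insert a (smallerMins s t a) else {a}

theorem le_of_mem_parents {s t : Setoid (Fin N)} {a b : Fin N} (h : b ∈ parents s t a) : b ≤ a := by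
  rw [parents] at h
  split_ifs at h
  · rcases Finset.mem_insert.1 h with rfl | h
    · exact le_rfl
    · exact (lt_of_mem_smallerMins h).le
  · exact (Finset.mem_singleton.1 h).le

theorem rel_of_mem_parents {s t : Setoid (Fin N)} {a b : Fin N} (h : b ∈ parents s t a) :
    t b a := by
  rw [parents] at h
  split_ifs at h
  · rcases Finset.mem_insert.1 h with rfl | h
    · exact t.refl _
    · exact rel_of_mem_smallerMins h
  · rw [Finset.mem_singleton.1 h]

theorem isBlockMin_of_mem_parents {s t : Setoid (Fin N)} {a b : Fin N} (ha : IsBlockMin s a)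
    (h : b ∈ parents s t a) : IsBlockMin s b := by
  rw [parents, if_pos ha] at h
  rcases Finset.mem_insert.1 h with rfl | h
  · exact ha
  · exact isBlockMin_of_mem_smallerMins h

/-- The root of the tree of `a`, in the forest given by the parent map `f`; an element which is not
a block minimum is attached to the minimum of its block. -/
noncomputable def forestRoot (s : Setoid (Fin N)) (f : Fin N → Fin N) (a : Fin N) : Fin N :=
  f^[N] (blockMin s a)

/-- The set partition into the trees of a forest. -/
noncomputable def forestSetoid (s : Setoid (Fin N)) (f : Fin N → Fin N) : Setoid (Fin N) :=
  Setoid.ker (forestRoot s f)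

/-- A map which never increases an element of `Fin N` becomes stationary within `N` steps. -/
theorem apply_iterate_eq_of_le {f : Fin N → Fin N} (hf : ∀ a, f a ≤ a) (a : Fin N) :
    f (f^[N] a) = f^[N] a := by
  have key : ∀ k, f (f^[k] a) = f^[k] a ∨ (f^[k] a).val + k ≤ a.val := by
    intro k
    induction k with
    | zero => exact Or.inr le_rfl
    | succ k ih =>
      rw [Function.iterate_succ_apply']
      rcases ih with ih | ih
      · left
        rw [ih, ih]
      · by_cases h : f (f^[k] a) = f^[k] a
        · left
          rw [h, h]
        · right
          have := Fin.lt_def.1 (lt_of_le_of_ne (hf (f^[k] a)) h)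
          omega
  rcases key N with h | h
  · exact h
  · have := a.2
    omega

section Root

variable {s t : Setoid (Fin N)} {f : Fin N → Fin N}

theorem apply_forestRoot (hf : ∀ a, f a ∈ parents s t a) (a : Fin N) :
    f (forestRoot s f a) = forestRoot s f a :=
  apply_iterate_eq_of_le (fun a => le_of_mem_parents (hf a)) _

theorem forestRoot_le (hf : ∀ a, f a ∈ parents s t a) (a : Fin N) : forestRoot s f a ≤ a := by
  have key : ∀ k b, f^[k] b ≤ b := by
    intro k b
    induction k with
    | zero => exact le_rfl
    | succ k ih =>
      rw [Function.iterate_succ_apply']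
      exact (le_of_mem_parents (hf _)).trans ih
  exact (key _ _).trans (blockMin_le s a)

theorem isBlockMin_forestRoot (hf : ∀ a, f a ∈ parents s t a) (a : Fin N) :
    IsBlockMin s (forestRoot s f a) := by
  have key : ∀ k b, IsBlockMin s b → IsBlockMin s (f^[k] b) := by
    intro k b hb
    induction k with
    | zero => exact hb
    | succ k ih =>
      rw [Function.iterate_succ_apply']
      exact isBlockMin_of_mem_parents ih (hf _)
  exact key _ _ (isBlockMin_blockMin s a)

theorem rel_forestRoot {z : Setoid (Fin N)} (hz : s ≤ z) (hfz : ∀ a, z (f a) a) (a : Fin N) :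
    z (forestRoot s f a) a := by
  have key : ∀ k b, z (f^[k] b) b := by
    intro k b
    induction k with
    | zero => exact z.refl _
    | succ k ih =>
      rw [Function.iterate_succ_apply']
      exact z.trans (hfz _) ih
  exact z.trans (key _ _) (hz (s.symm (rel_blockMin s a)))

theorem forestRoot_eq_self {a : Fin N} (ha : IsBlockMin s a) (h : f a = a) :
    forestRoot s f a = a := by
  rw [forestRoot, ha.blockMin_eq]
  exact Function.iterate_fixed h N

theorem forestSetoid_apply (hf : ∀ a, f a ∈ parents s t a) (a : Fin N) :
    forestSetoid s f (f a) a := by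
  by_cases ha : IsBlockMin s a
  · have h1 : IsBlockMin s (f a) := isBlockMin_of_mem_parents ha (hf a)
    change forestRoot s f (f a) = forestRoot s f a
    have h2 := apply_forestRoot hf a
    rw [forestRoot, forestRoot, h1.blockMin_eq, ha.blockMin_eq, ← Function.iterate_succ_apply,
      Function.iterate_succ_apply']
    rwa [forestRoot, ha.blockMin_eq] at h2
  · have h1 := hf a
    rw [parents, if_neg ha, Finset.mem_singleton] at h1
    rw [h1]

theorem le_forestSetoid : s ≤ forestSetoid s f := fun {a b} h => by
  change forestRoot s f a = forestRoot s f b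
  rw [forestRoot, forestRoot, blockMin_eq_iff.2 h]

/-- The partition into trees is the finest partition coarser than `s` whose blocks are respected by
`f`. -/
theorem forestSetoid_le {z : Setoid (Fin N)} (hz : s ≤ z) (hfz : ∀ a, z (f a) a) :
    forestSetoid s f ≤ z := fun {a b} h => by
  have h' : forestRoot s f a = forestRoot s f b := h
  refine z.trans (z.symm (rel_forestRoot hz hfz a)) ?_
  rw [h']
  exact rel_forestRoot hz hfz b

end Root

theorem IsBlockMin.mono {s z : Setoid (Fin N)} (h : s ≤ z) {a : Fin N} (ha : IsBlockMin z a) :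
    IsBlockMin s a := fun b hb => ha b (h hb)

open Classical in
/-- The parents of `a` in an increasing forest whose partition into trees is `z`: exactly the
minima of blocks of `z` are roots. -/
noncomputable def treeParents (s z : Setoid (Fin N)) (a : Fin N) : Finset (Fin N) :=
  if IsBlockMin s a ∧ ¬ IsBlockMin z a then smallerMins s z a else {a}

/-- The increasing forests with a given partition `z` into trees are obtained by an independent
choice of a parent for each element which is not the minimum of a block of `z`. -/
theorem forestSetoid_eq_iff {s t z : Setoid (Fin N)} (hsz : s ≤ z) (hzt : z ≤ t)
    {f : Fin N → Fin N} :
    ((∀ a, f a ∈ parents s t a) ∧ forestSetoid s f = z) ↔ ∀ a, f a ∈ treeParents s z a := by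
  constructor
  · rintro ⟨hf, rfl⟩ a
    have hfa := hf a
    have hz := forestSetoid_apply hf a
    rw [parents] at hfa
    rw [treeParents]
    split_ifs at hfa with ha
    · split_ifs with hza
      · rcases Finset.mem_insert.1 hfa with h | h
        · refine absurd (fun b hb => ?_) hza.2
          have hb' : forestRoot s f a = forestRoot s f b := hb
          rw [forestRoot_eq_self ha h] at hb'
          rw [hb']
          exact forestRoot_le hf b
        · simp only [smallerMins, Finset.mem_filter, Finset.mem_univ, true_and] at h ⊢
          exact ⟨h.1, h.2.1, hz⟩
      · have hza' : IsBlockMin (forestSetoid s f) a := by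
          by_contra h
          exact hza ⟨ha, h⟩
        rw [Finset.mem_singleton]
        exact le_antisymm (le_of_mem_parents (hf a))
          (hza' _ ((forestSetoid s f).symm hz))
    · rw [if_neg fun h => ha h.1]
      exact hfa
  · intro hf
    have hfz : ∀ a, z (f a) a := by
      intro a
      have := hf a
      rw [treeParents] at this
      split_ifs at this
      · exact rel_of_mem_smallerMins this
      · rw [Finset.mem_singleton.1 this]
    have hfp : ∀ a, f a ∈ parents s t a := by
      intro a
      have := hf a
      rw [treeParents] at this
      rw [parents]
      split_ifs at this with h
      · rw [if_pos h.1]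
        refine Finset.mem_insert_of_mem ?_
        simp only [smallerMins, Finset.mem_filter, Finset.mem_univ, true_and] at this ⊢
        exact ⟨this.1, this.2.1, hzt this.2.2⟩
      · rw [Finset.mem_singleton.1 this]
        split_ifs <;> simp
    have hroot : ∀ a, IsBlockMin z (forestRoot s f a) := by
      intro a
      by_contra h
      have h1 := hf (forestRoot s f a)
      rw [treeParents, if_pos ⟨isBlockMin_forestRoot hfp a, h⟩] at h1
      exact (lt_of_mem_smallerMins h1).ne (apply_forestRoot hfp a)
    refine ⟨hfp, le_antisymm (forestSetoid_le hsz hfz) fun {a b} hab => ?_⟩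
    refine (hroot a).eq_of_rel (hroot b) ?_
    exact z.trans (rel_forestRoot hsz hfz a)
      (z.trans hab (z.symm (rel_forestRoot hsz hfz b)))

open Classical in
/-- The generating function of the increasing forests on the block minima of `s` whose partition
into trees is `z`, with `y` to the number of edges. -/
noncomputable def treePoly (y : K) (s z : Setoid (Fin N)) : K :=
  ∏ a with IsBlockMin s a ∧ ¬ IsBlockMin z a, (y * (smallerMins s z a).card)

open Classical in
theorem treePoly_eq_sum (y : K) {s z : Setoid (Fin N)} :
    treePoly y s z = ∑ f ∈ Fintype.piFinset (treeParents s z),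
      ∏ a, if f a = a then 1 else y := by
  rw [← Finset.prod_univ_sum (treeParents s z) fun a b => if b = a then 1 else y, treePoly,
    Finset.prod_filter]
  refine Finset.prod_congr rfl fun a _ => ?_
  rw [treeParents]
  split_ifs with h
  · rw [Finset.sum_congr rfl fun b hb => if_neg (lt_of_mem_smallerMins hb).ne]
    simp [mul_comm]
  · simp

open Classical in
theorem partitionPoin_eq_sum (y : K) {s t : Setoid (Fin N)} :
    partitionPoin y s t = ∑ f ∈ Fintype.piFinset (parents s t),
      ∏ a, if f a = a then 1 else y := by
  rw [← Finset.prod_univ_sum (parents s t) fun a b => if b = a then 1 else y, partitionPoin,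
    Finset.prod_filter]
  refine Finset.prod_congr rfl fun a _ => ?_
  rw [parents]
  split_ifs with h
  · rw [Finset.sum_insert fun h => (lt_of_mem_smallerMins h).false, if_pos rfl,
      Finset.sum_congr rfl fun b hb => if_neg (lt_of_mem_smallerMins hb).ne]
    simp [mul_comm]
  · simp

open Classical in
/-- Increasing forests are sorted by their partition into trees. -/
theorem sum_treePoly (y : K) [Fintype (Setoid (Fin N))] {s t : Setoid (Fin N)} (hst : s ≤ t) :
    ∑ z with s ≤ z ∧ z ≤ t, treePoly y s z = partitionPoin y s t := by
  rw [partitionPoin_eq_sum, ← Finset.sum_fiberwise_of_maps_to (g := forestSetoid s)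
    (t := Finset.univ.filter fun z => s ≤ z ∧ z ≤ t)]
  · refine Finset.sum_congr rfl fun z hz => ?_
    simp only [Finset.mem_filter, Finset.mem_univ, true_and] at hz
    rw [treePoly_eq_sum]
    refine Finset.sum_congr ?_ fun _ _ => rfl
    ext f
    simp only [Finset.mem_filter, Fintype.mem_piFinset]
    exact (forestSetoid_eq_iff hz.1 hz.2).symm
  · intro f hf
    rw [Fintype.mem_piFinset] at hf
    simp only [Finset.mem_filter, Finset.mem_univ, true_and]
    exact ⟨le_forestSetoid, forestSetoid_le hst fun a => rel_of_mem_parents (hf a)⟩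

theorem treePoly_self (y : K) (s : Setoid (Fin N)) : treePoly y s s = 1 := by
  classical
  rw [treePoly, Finset.filter_false_of_mem, Finset.prod_empty]
  simp

/-- If `s < t`, some block of `t` has a second smallest minimum of a block of `s`, whose factor
`1 + y` vanishes. -/
theorem partitionPoin_neg_one {s t : Setoid (Fin N)} (hst : s < t) :
    partitionPoin (-1 : K) s t = 0 := by
  classical
  -- the smallest block minimum of `s` which is not a block minimum of `t`
  have hne : (Finset.univ.filter fun a => IsBlockMin s a ∧ ¬ IsBlockMin t a).Nonempty := by
    by_contra h
    rw [Finset.not_nonempty_iff_eq_empty, Finset.filter_eq_empty_iff] at h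
    refine hst.not_ge fun {a b} hab => ?_
    have hmin : ∀ a, IsBlockMin t (blockMin s a) := fun a => by
      by_contra h'
      exact h (Finset.mem_univ (blockMin s a)) ⟨isBlockMin_blockMin s a, h'⟩
    rw [← blockMin_eq_iff]
    exact (hmin a).eq_of_rel (hmin b) (t.trans (t.symm (hst.le (rel_blockMin s a)))
      (t.trans hab (hst.le (rel_blockMin s b))))
  obtain ⟨a, ha, hmin⟩ := Finset.exists_min_image _ id hne
  simp only [Finset.mem_filter, Finset.mem_univ, true_and, id] at ha hmin
  refine Finset.prod_eq_zero (Finset.mem_filter.2 ⟨Finset.mem_univ a, ha.1⟩) ?_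
  have h1 : smallerMins s t a = {blockMin t a} := by
    ext b
    simp only [smallerMins, Finset.mem_filter, Finset.mem_univ, true_and, Finset.mem_singleton]
    constructor
    · rintro ⟨hb, hbs, hba⟩
      have hbt : IsBlockMin t b := by
        by_contra h
        exact hb.not_ge (hmin b ⟨hbs, h⟩)
      exact hbt.eq_of_rel (isBlockMin_blockMin t a) (t.trans hba (rel_blockMin t a))
    · rintro rfl
      refine ⟨lt_of_le_of_ne (blockMin_le t a) fun h => ha.2 ?_,
        (isBlockMin_blockMin t a).mono hst.le, t.symm (rel_blockMin t a)⟩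
      rw [← h]
      exact isBlockMin_blockMin t a
  rw [h1]
  simp

end Forests

/-! ### The flats of the braid arrangement -/

section BraidFlats

variable {n : ℕ}

/-- The set partition of the coordinates that belongs to a flat: two coordinates are equivalent if
they agree on the flat. -/
def flatSetoid (F : (braidArrangement n).Flat) : Setoid (Fin (n + 1)) where
  r i j := ∀ x ∈ F.space, x.1 i = x.1 j
  iseqv := ⟨fun _ _ _ => rfl, fun h x hx => (h x hx).symm,
    fun h h' x hx => (h x hx).trans (h' x hx)⟩

/-- The flat of all vectors which are constant on the blocks of `s`. -/
def setoidFlat (s : Setoid (Fin (n + 1))) : (braidArrangement n).Flat where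
  space := sInf {H | ∃ i j, i < j ∧ s i j ∧ H = braidHyperplane n i j}
  isFlat := by
    refine ⟨_, ?_, rfl⟩
    rintro H ⟨i, j, hij, -, h⟩
    exact ⟨i, j, hij, h⟩

theorem mem_setoidFlat {s : Setoid (Fin (n + 1))} {x : BraidSpace n} :
    x ∈ (setoidFlat s).space ↔ ∀ i j, s i j → x.1 i = x.1 j := by
  simp only [setoidFlat, Submodule.mem_sInf, Set.mem_ofPred_eq]
  constructor
  · intro h i j hij
    rcases lt_trichotomy i j with hlt | rfl | hlt
    · exact mem_braidHyperplane.1 (h _ ⟨i, j, hlt, hij, rfl⟩)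
    · rfl
    · exact (mem_braidHyperplane.1 (h _ ⟨j, i, hlt, s.symm hij, rfl⟩)).symm
  · rintro h H ⟨i, j, -, hij, rfl⟩
    exact mem_braidHyperplane.2 (h i j hij)

open Classical in
theorem flatSetoid_setoidFlat (s : Setoid (Fin (n + 1))) : flatSetoid (setoidFlat s) = s := by
  ext i j
  constructor
  · intro h
    by_contra hij
    -- the indicator function of the block of `i`, shifted to coordinate sum zero
    set v : Fin (n + 1) → ℝ := fun k => if s i k then 1 else 0 with hv
    set c : ℝ := (∑ k, v k) / (n + 1) with hc
    have hmem : (fun k => v k - c) ∈ BraidSpace n := by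
      have : (n : ℝ) + 1 ≠ 0 := by positivity
      rw [LinearMap.mem_ker, LinearMap.sum_apply]
      simp only [LinearMap.proj_apply, Finset.sum_sub_distrib, Finset.sum_const, Finset.card_univ,
        Fintype.card_fin, nsmul_eq_mul, Nat.cast_add, Nat.cast_one]
      rw [hc]
      field_simp
      ring
    have h1 := h ⟨_, hmem⟩ (mem_setoidFlat.2 fun a b hab => by
      have : s i a ↔ s i b := ⟨fun h => s.trans h hab, fun h => s.trans h (s.symm hab)⟩
      simp [hv, this])
    simp [hv, hij] at h1
  · exact fun h x hx => mem_setoidFlat.1 hx i j h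

theorem setoidFlat_flatSetoid (F : (braidArrangement n).Flat) : setoidFlat (flatSetoid F) = F := by
  refine HyperplaneArrangement.Flat.ext (le_antisymm ?_ ?_)
  · obtain ⟨S, hS, hF⟩ := F.isFlat
    intro x hx
    rw [hF, Submodule.mem_sInf]
    intro H hH
    obtain ⟨i, j, -, rfl⟩ := hS hH
    refine mem_braidHyperplane.2 (mem_setoidFlat.1 hx i j fun z hz => ?_)
    rw [hF, Submodule.mem_sInf] at hz
    exact mem_braidHyperplane.1 (hz _ hH)
  · exact fun x hx => mem_setoidFlat.2 fun i j h => h x hx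

/-- The lattice of flats of the braid arrangement is the lattice of set partitions. -/
def flatOrderIso (n : ℕ) : (braidArrangement n).Flat ≃o Setoid (Fin (n + 1)) where
  toFun := flatSetoid
  invFun := setoidFlat
  left_inv := setoidFlat_flatSetoid
  right_inv := flatSetoid_setoidFlat
  map_rel_iff' {F G} := by
    constructor
    · intro h x hx
      rw [← setoidFlat_flatSetoid F]
      exact mem_setoidFlat.2 fun i j hij => h hij x hx
    · exact fun h i j hij x hx => hij x (h hx)

theorem flatSetoid_le_iff {F G : (braidArrangement n).Flat} :
    flatSetoid F ≤ flatSetoid G ↔ F ≤ G := (flatOrderIso n).le_iff_le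

open Classical in
theorem finrank_setoidFlat (s : Setoid (Fin (n + 1))) :
    Module.finrank ℝ (setoidFlat s).space + 1 = (Finset.univ.filter (IsBlockMin s)).card := by
  let q : Fin (n + 1) → {a // IsBlockMin s a} := fun a => ⟨blockMin s a, isBlockMin_blockMin s a⟩
  have hq : ∀ a : {a // IsBlockMin s a}, q a = a := fun a => Subtype.ext a.2.blockMin_eq
  let ψ : ({a // IsBlockMin s a} → ℝ) →ₗ[ℝ] (Fin (n + 1) → ℝ) := LinearMap.funLeft ℝ ℝ q
  let ℓ : ({a // IsBlockMin s a} → ℝ) →ₗ[ℝ] ℝ :=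
    (∑ i, LinearMap.proj i : (Fin (n + 1) → ℝ) →ₗ[ℝ] ℝ) ∘ₗ ψ
  let θ : LinearMap.ker ℓ →ₗ[ℝ] BraidSpace n :=
    (ψ ∘ₗ (LinearMap.ker ℓ).subtype).codRestrict (BraidSpace n) fun v => v.2
  have hθ : Function.Injective θ := by
    intro v v' h
    refine Subtype.ext (funext fun a => ?_)
    have := congrFun (congrArg Subtype.val h) a
    change v.1 (q a) = v'.1 (q a) at this
    rwa [hq] at this
  have hrange : LinearMap.range θ = (setoidFlat s).space := by
    ext x
    rw [LinearMap.mem_range, mem_setoidFlat]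
    constructor
    · rintro ⟨v, rfl⟩ i j hij
      change v.1 (q i) = v.1 (q j)
      rw [show q i = q j from Subtype.ext (blockMin_eq_iff.2 hij)]
    · intro hx
      have hψ : ψ (fun a => x.1 a) = x.1 := funext fun i =>
        hx _ _ (s.symm (rel_blockMin s i))
      refine ⟨⟨fun a => x.1 a, ?_⟩, Subtype.ext hψ⟩
      change (∑ i, LinearMap.proj i : (Fin (n + 1) → ℝ) →ₗ[ℝ] ℝ) (ψ fun a => x.1 a) = 0
      rw [hψ]
      exact x.2
  have hℓ : Function.Surjective ℓ := by
    refine LinearMap.surjective fun h0 => ?_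
    have h1 := LinearMap.congr_fun h0 fun _ => 1
    change (∑ i, LinearMap.proj i : (Fin (n + 1) → ℝ) →ₗ[ℝ] ℝ) (fun _ => 1) = 0 at h1
    rw [LinearMap.sum_apply] at h1
    simp only [LinearMap.proj_apply, Finset.sum_const, Finset.card_univ, Fintype.card_fin,
      nsmul_eq_mul, mul_one] at h1
    exact (Nat.cast_ne_zero.2 n.succ_ne_zero) h1
  have h := LinearMap.finrank_range_add_finrank_ker ℓ
  rw [LinearMap.range_eq_top.2 hℓ, finrank_top, Module.finrank_self,
    Module.finrank_fintype_fun_eq_card, ← LinearMap.finrank_range_of_inj hθ, hrange,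
    Fintype.card_subtype] at h
  rw [← h, add_comm]

open Classical in
/-- The rank of an interval of flats counts the block minima that get lost. -/
theorem finrank_sub_finrank {F G : (braidArrangement n).Flat} (h : F ≤ G) :
    Module.finrank ℝ F.space - Module.finrank ℝ G.space =
      (Finset.univ.filter fun a => IsBlockMin (flatSetoid F) a ∧
        ¬ IsBlockMin (flatSetoid G) a).card := by
  have hF := finrank_setoidFlat (flatSetoid F)
  have hG := finrank_setoidFlat (flatSetoid G)
  rw [setoidFlat_flatSetoid] at hF hG
  have hFG := Finset.card_filter_add_card_filter_not
    (s := Finset.univ.filter (IsBlockMin (flatSetoid F))) (IsBlockMin (flatSetoid G))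
  rw [Finset.filter_filter, Finset.filter_filter] at hFG
  have hG' : (Finset.univ.filter fun a => IsBlockMin (flatSetoid F) a ∧
      IsBlockMin (flatSetoid G) a) = Finset.univ.filter (IsBlockMin (flatSetoid G)) := by
    ext a
    simp only [Finset.mem_filter, Finset.mem_univ, true_and, and_iff_right_iff_imp]
    exact fun ha => ha.mono (flatSetoid_le_iff.2 h)
  rw [hG'] at hFG
  omega

theorem finrank_braidSpace (n : ℕ) : Module.finrank ℝ (BraidSpace n) = n := by
  classical
  have h := finrank_setoidFlat (⊥ : Setoid (Fin (n + 1)))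
  have h1 : (setoidFlat (⊥ : Setoid (Fin (n + 1)))).space = ⊤ :=
    top_le_iff.1 fun x _ => mem_setoidFlat.2 fun i j hij => by
      rw [show i = j from hij]
  have h2 : Finset.univ.filter (IsBlockMin (⊥ : Setoid (Fin (n + 1)))) = Finset.univ :=
    Finset.filter_true_of_mem fun a _ b hb => le_of_eq hb
  rw [h1, finrank_top, h2, Finset.card_univ, Fintype.card_fin] at h
  omega

open Classical in
theorem sum_Icc_treePoly {K : Type*} [CommRing K] (y : K) {F G : (braidArrangement n).Flat}
    (h : F ≤ G) : ∑ Z ∈ Finset.Icc F G, treePoly y (flatSetoid F) (flatSetoid Z) =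
      partitionPoin y (flatSetoid F) (flatSetoid G) := by
  have : Fintype (Setoid (Fin (n + 1))) := Fintype.ofEquiv _ (flatOrderIso n).toEquiv
  rw [← sum_treePoly y (flatSetoid_le_iff.2 h)]
  refine Finset.sum_equiv (flatOrderIso n).toEquiv (fun Z => ?_) fun _ _ => rfl
  simp only [Finset.mem_Icc, Finset.mem_filter, Finset.mem_univ, true_and]
  exact and_congr flatSetoid_le_iff.symm flatSetoid_le_iff.symm

open Classical in
/-- Up to sign, the Möbius function counts increasing forests: both satisfy the same recursion. -/
theorem mu_braidArrangement {F G : (braidArrangement n).Flat} (h : F ≤ G) :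
    IncidenceAlgebra.mu ℤ F G = treePoly (-1) (flatSetoid F) (flatSetoid G) := by
  induction G using (wellFounded_lt (α := (braidArrangement n).Flat)).induction with
  | _ G ih =>
  rcases eq_or_ne F G with rfl | hne
  · rw [IncidenceAlgebra.mu_self, treePoly_self]
  · have hlt : flatSetoid F < flatSetoid G := (flatOrderIso n).lt_iff_lt.2 (lt_of_le_of_ne h hne)
    have h1 := sum_Icc_treePoly (-1 : ℤ) h
    rw [partitionPoin_neg_one hlt, ← Finset.Ico_insert_right h,
      Finset.sum_insert Finset.right_notMem_Ico] at h1
    rw [IncidenceAlgebra.mu_eq_neg_sum_Ico_of_ne hne, eq_neg_of_add_eq_zero_left h1, neg_inj]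
    refine Finset.sum_congr rfl fun Z hZ => ?_
    rw [Finset.mem_Ico] at hZ
    exact ih Z hZ.2 hZ.1

theorem poin_braidArrangement {F G : (braidArrangement n).Flat} (h : F ≤ G) :
    (braidArrangement n).poin F G = partitionPoin X (flatSetoid F) (flatSetoid G) := by
  classical
  rw [← sum_Icc_treePoly X h, HyperplaneArrangement.poin]
  refine Finset.sum_congr rfl fun Z hZ => ?_
  rw [Finset.mem_Icc] at hZ
  rw [mu_braidArrangement hZ.1, finrank_sub_finrank hZ.1, treePoly, treePoly, map_prod,
    ← Finset.prod_const, ← Finset.prod_mul_distrib]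
  refine Finset.prod_congr rfl fun a _ => ?_
  simp [mul_comm]

end BraidFlats

/-! ### The numerator polynomial -/

section Numerator

variable {n : ℕ}

theorem wordComp_univ (w : Equiv.Perm (Fin (n + 1))) :
    wordComp w Finset.univ = SetComposition.ofPerm id w.symm := by
  ext a b
  constructor
  · intro h
    change w.symm a ≤ w.symm b
    induction hp : w.symm a using Fin.cases with
    | zero => exact Fin.zero_le _
    | succ r => exact h r (Finset.mem_univ r) hp.ge
  · exact fun h => wordComp_le h

open Classical in
/-- The permutations are the compositions into singletons. -/
theorem sum_roundSum_univ {K : Type*} [CommRing K] (y u : K) :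
    ∑ w : Equiv.Perm (Fin (n + 1)), roundSum w y u Finset.univ =
      ∑ c : SetComposition (Fin (n + 1)) with c.ker = ⊥, chainSum (mergeWeight y) u c := by
  have hid : Setoid.ker (id : Fin (n + 1) → Fin (n + 1)) = ⊥ :=
    Setoid.ker_eq_bot_iff.2 fun _ _ h => h
  refine Finset.sum_bij (fun w _ => wordComp w Finset.univ) ?_ ?_ ?_ fun _ _ => rfl
  · intro w _
    rw [wordComp_univ, Finset.mem_filter, SetComposition.ker_ofPerm, hid]
    exact ⟨Finset.mem_univ _, rfl⟩
  · intro w _ w' _ h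
    rw [wordComp_univ, wordComp_univ] at h
    exact Equiv.symm_bijective.injective
      (SetComposition.ofPerm_injective Function.surjective_id h)
  · intro c hc
    obtain ⟨e, rfl⟩ := SetComposition.exists_ofPerm_eq Function.surjective_id c
      ((Finset.mem_filter.1 hc).2.trans hid.symm)
    exact ⟨e.symm, Finset.mem_univ _, by rw [wordComp_univ, Equiv.symm_symm]⟩

theorem map_partitionPoin {K L : Type*} [CommRing K] [CommRing L] (φ : K →+* L) (y : K)
    {N : ℕ} (s t : Setoid (Fin N)) : φ (partitionPoin y s t) = partitionPoin (φ y) s t := by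
  simp [partitionPoin]

open Classical in
/-- Chains of set compositions which start at a composition into singletons have the same total
weight as chains of flats. -/
theorem sum_chainSum_mergeWeight {K : Type*} [CommRing K] (φ : ℤ[X] →+* K) (u : K) :
    ∑ c : SetComposition (Fin (n + 1)) with c.ker = ⊥, chainSum (mergeWeight (φ X)) u c =
      chainSum (fun F G => φ ((braidArrangement n).poin F G)) u ⊥ := by
  have hbot : ∀ s, s = ⊥ ↔ setoidFlat s = (⊥ : (braidArrangement n).Flat) := fun s =>
    
    (map_eq_bot_iff (flatOrderIso n).symm).symm
  rw [← sum_fiber_chainSum (fun c : SetComposition (Fin (n + 1)) => setoidFlat c.ker)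
    ((flatOrderIso n).symm.strictMono.comp SetComposition.ker_strictMono)
    (by
      rw [SetComposition.ker_top]
      exact (flatOrderIso n).symm.map_top) (mergeWeight (φ X))]
  · simp only [hbot]
  · intro F d h
    have h' : flatSetoid F ≤ d.ker := by
      rw [← flatSetoid_setoidFlat d.ker]
      exact flatSetoid_le_iff.2 h
    rw [poin_braidArrangement h, map_partitionPoin, flatSetoid_setoidFlat,
      ← sum_mergeWeight (φ X) (flatSetoid F) d h']
    refine Finset.sum_congr ?_ fun _ _ => rfl
    ext c
    simp only [Finset.mem_filter, Finset.mem_univ, true_and]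
    refine and_congr_left fun _ => ⟨fun hc => ?_, fun hc => ?_⟩
    · rw [← hc, flatSetoid_setoidFlat]
    · rw [hc, setoidFlat_flatSetoid]

theorem one_sub_ratFuncX_ne_zero : (1 - RatFunc.X : RatFunc ℤ[X]) ≠ 0 := by
  rw [← RatFunc.algebraMap_X, ← map_one (algebraMap ℤ[X][X] (RatFunc ℤ[X])), ← map_sub]
  refine (map_ne_zero_iff _ (RatFunc.algebraMap_injective _)).2 fun h => ?_
  have := congrArg (fun p => coeff p 0) h
  simp at this

theorem cfHP_braidArrangement (n : ℕ) :
    (1 - RatFunc.X) ^ n * (braidArrangement n).cfHP =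
      algebraMap ℤ[X][X] (RatFunc ℤ[X]) (∑ w : Equiv.Perm (Fin (n + 1)),
        ∑ σ : Equiv.Perm (Fin n), C (X ^ ino w σ) * X ^ descentNumber σ) := by
  have hu : (1 - RatFunc.X : RatFunc ℤ[X]) * (RatFunc.X / (1 - RatFunc.X)) = RatFunc.X :=
    mul_div_cancel₀ _ one_sub_ratFuncX_ne_zero
  rw [HyperplaneArrangement.cfHP_eq_chainSum, ← sum_chainSum_mergeWeight RatFunc.C,
    ← sum_roundSum_univ, Finset.mul_sum, map_sum]
  refine Finset.sum_congr rfl fun w _ => ?_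
  rw [← sum_perm_ino_descentNumber w _ hu, map_sum]
  refine Finset.sum_congr rfl fun σ _ => ?_
  simp [RatFunc.algebraMap_C, RatFunc.algebraMap_X]

end Numerator

theorem mainTheorem1 (n : ℕ) (N : ℤ[X][X]) :
    (braidArrangement n).IsNumerator N ↔
      N = ∑ w : Equiv.Perm (Fin (n + 1)), ∑ σ : Equiv.Perm (Fin n),
        C (X ^ ino w σ) * X ^ descentNumber σ := by
  have hX : (1 - RatFunc.X : RatFunc ℤ[X]) ^ n ≠ 0 :=
    pow_ne_zero _ one_sub_ratFuncX_ne_zero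
  rw [HyperplaneArrangement.IsNumerator, finrank_braidSpace, eq_div_iff hX, mul_comm,
    cfHP_braidArrangement, (RatFunc.algebraMap_injective ℤ[X]).eq_iff, eq_comm]
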